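/- **Setting.** Let $E\subseteq\mathbb{R}^d$ be open, and let $(\lambda,\mathcal{Q},\Phi)$ be the local characteristics of a piecewise-deterministic Markov process on $E$: a flow $\Phi:\mathbb{R}^d\times\mathbb{R}\to\mathbb{R}^d$ (measurable, continuous in time, $\Phi(x,0)=x$, $\Phi(x,t+s)=\Phi(\Phi(x,t),s)$), a measurable jump rate $\lambda:\mathbb{R}^d\to\mathbb{R}_+$ such that for every $x\in E$ there is $\varepsilon>0$ with $\int_0^\varepsilon\lambda(\Phi(x,s))\,ds<\infty$, and a Markov kernel $\mathcal{Q}$ on $\mathbb{R}^d$ that has a density with respect to Lebesgue measure and satisfies $\mathcal{Q}(x,E\setminus\{x\})=1$ for all $x\in\overline{E}$. Let $t^+(x)=\inf\{t>0:\Phi(x,t)\in\partial E\}\in[0,\infty]$, and assume $\int_0^\infty\lambda(\Phi(x,s))\,ds=\infty$ for every $x\in E$ whose trajectory never reaches $\partial E$ in positive time (so that jumps occur after a finite time). For $x\in E$ let $\mathcal{S}(x,\cdot)$ be the distribution on $\mathbb{R}_+$ with $\mathcal{S}(x,(t,\infty))=\exp\left(-\int_0^t\lambda(\Phi(x,s))\,ds\right)$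 if $0\le t<t^+(x)$, and $\mathcal{S}(x,(t,\infty))=0$ if $t\ge t^+(x)$. Let $(Z_n)_{n\ge0}$ be the post-jump locations and $(S_{n+1})_{n\ge0}$ the inter-jumping times: $Z_0\in E$ almost surely, $S_1$ has conditional law $\mathcal{S}(Z_0,\cdot)$ given $Z_0$, and $(Z_n,S_{n+1})_{n\ge0}$ is a Markov chain with kernel $\mathcal{R}((x,t),A\times B)=\int_A\mathcal{Q}(\Phi(x,t),d\xi)\,\mathcal{S}(\xi,B)$. The chain $(Z_n)$ has transition kernel $\mathcal{P}(x,A)=\int_{\mathbb{R}_+}\mathcal{S}(x,dt)\,\mathcal{Q}(\Phi(x,t),A)$; let $\nu_n$ be the distribution of $Z_n$. **Estimators.** Let $\mathbb{K}_d:\mathbb{R}^d\to\mathbb{R}$ and $\mathbb{K}_1:\mathbb{R}\to\mathbb{R}$ be nonnegative, continuous, bounded functions of integral $1$ that vanish outside the ball of radius $\delta>0$ around $0$, with $\mathbb{K}_d$ Lipschitz. For $\alpha,\beta,v_0,w_0>0$ put $v_i=v_0(i+1)^{-\alpha}$, $w_i=w_0(i+1)^{-\beta}$ and, for $n\ge1$,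 $$\widehat{\mathcal{F}}^n(x,t)=\frac1n\sum_{i=0}^{n-1}\frac{1}{v_i^dw_i}\,\mathbb{K}_d\!\left(\frac{Z_i-x}{v_i}\right)\mathbb{K}_1\!\left(\frac{S_{i+1}-t}{w_i}\right),$$ $$\widehat{\mathcal{G}}^n(x,t)=\frac1n\sum_{i=0}^{n-1}\frac{1}{v_i^d}\,\mathbb{K}_d\!\left(\frac{Z_i-x}{v_i}\right)\mathbb{1}_{\{S_{i+1}>t\}},\qquad \widehat{\nu}^n_\infty(x)=\frac1n\sum_{i=0}^{n-1}\frac{1}{v_i^d}\,\mathbb{K}_d\!\left(\frac{Z_i-x}{v_i}\right).$$ Let $\mathcal{C}$ be the class of all sets $C\times[0,T]$ with $T\ge0$, $C$ a compact subset of $E$ and $T<\inf_{x\in C}t^+(x)$. **Proposition 1.** Assume that $(Z_n)$ is geometrically ergodic: there are $b>1$ and a probability distribution $\nu_\infty$ on $E$ such that $\|\mathcal{P}^n(x,\cdot)-\nu_\infty\|_{TV}=O(b^{-n})$ for every $x\in E$ (with a constant that may depend on $x$), and $\|\nu_n-\nu_\infty\|_{TV}=O(b^{-n})$ for the given initial distribution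 $\nu_0$ (this is part of the preceding condition when $Z_0$ is deterministic). Then, for every set $C\times[0,T]\in\mathcal{C}$ and all $\alpha,\beta,v_0,w_0>0$ with $2(\alpha d+\beta)<1$, the estimators are square integrable at every $(x,t)\in C\times[0,T]$ and $$\sup_{(x,t)\in C\times[0,T]}\mathrm{Var}\big(\widehat{\mathcal{F}}^n(x,t)\big)=O\big(n^{2(\alpha d+\beta)-1}\big),$$ $$\sup_{(x,t)\in C\times[0,T]}\Big(\mathrm{Var}\big(\widehat{\mathcal{G}}^n(x,t)\big)+\mathrm{Var}\big(\widehat{\nu}^n_\infty(x)\big)\Big)=O\big(n^{2\alpha d-1}\big).$$ -/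

import Mathlib

open MeasureTheory ProbabilityTheory Set Filter Topology Asymptotics
open scoped ENNReal NNReal

noncomputable section

/-- The Euclidean space `ℝᵈ`. -/
abbrev Space (d : ℕ) : Type := EuclideanSpace ℝ (Fin d)

/-- The local characteristics `(λ, 𝒬, Φ)` of a piecewise-deterministic Markov process on an open
set `E ⊆ ℝᵈ`, with the standard conditions that make its jumps well defined. -/
structure PDMP (d : ℕ) where
  /-- the state space -/
  E : Set (Space d)
  isOpen_E : IsOpen E
  /-- the deterministic flow -/
  Φ : Space d → ℝ → Space d
  measurable_Φ : Measurable (Function.uncurry Φ)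
  continuous_Φ : ∀ x, Continuous (Φ x)
  Φ_zero : ∀ x, Φ x 0 = x
  Φ_add : ∀ x t s, Φ x (t + s) = Φ (Φ x t) s
  /-- the jump rate -/
  rate : Space d → ℝ≥0
  measurable_rate : Measurable rate
  /-- the transition kernel -/
  Q : Kernel (Space d) (Space d)
  isMarkov_Q : IsMarkovKernel Q
  /-- the density of the transition kernel with respect to the Lebesgue measure -/
  q : Space d → Space d → ℝ≥0∞
  measurable_q : ∀ x, Measurable (q x)
  Q_eq_withDensity : ∀ x, Q x = volume.withDensity (q x)
  Q_closure : ∀ x ∈ closure E, Q x (E \ {x}) = 1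
  rate_integrable : ∀ x ∈ E, ∃ ε > 0, ∫⁻ s in Ioo (0 : ℝ) ε, (rate (Φ x s) : ℝ≥0∞) < ∞
  /-- A trajectory that never reaches the boundary jumps almost surely in finite time, i.e. the
  conditional law of the inter-jumping times is a probability distribution on `[0, ∞)`. -/
  jump_finite : ∀ x ∈ E, (∀ t > 0, Φ x t ∉ frontier E) →
    ∫⁻ s in Ioi (0 : ℝ), (rate (Φ x s) : ℝ≥0∞) = ∞

namespace PDMP

variable {d : ℕ} (X : PDMP d)

instance : IsMarkovKernel X.Q := X.isMarkov_Q

/-- The deterministic exit time `t⁺(x) = inf {t > 0 : Φ(x,t) ∈ ∂E}`, equal to `∞` if the boundary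
is never reached. -/
def exitTime (x : Space d) : ℝ≥0∞ :=
  ⨅ (t : ℝ) (_ : 0 < t ∧ X.Φ x t ∈ frontier X.E), ENNReal.ofReal t

/-- The integrated rate `∫₀ᵗ λ(Φ(x,s)) ds`. -/
def hazard (x : Space d) (t : ℝ) : ℝ≥0∞ :=
  ∫⁻ s in Ioo (0 : ℝ) t, (X.rate (X.Φ x s) : ℝ≥0∞)

/-- The inter-jumping time from `x` for which the threshold of the integrated rate is `e`: the
first time at which the integrated rate reaches `e` or the boundary is hit. -/
def jumpTime (x : Space d) (e : ℝ) : ℝ≥0∞ :=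
  ⨆ (t : ℝ) (_ : 0 ≤ t ∧ ENNReal.ofReal t < X.exitTime x ∧ X.hazard x t < ENNReal.ofReal e),
    ENNReal.ofReal t

lemma exitTime_lt_iff (x : Space d) (r : ℝ≥0∞) :
    X.exitTime x < r ↔ ∃ t : ℝ, (0 < t ∧ X.Φ x t ∈ frontier X.E) ∧ ENNReal.ofReal t < r := by
  simp only [exitTime, iInf_lt_iff, exists_prop]

lemma measurable_exitTime : Measurable X.exitTime := by
  refine measurable_of_Iio fun r => ?_
  have hmem : ∀ x : Space d, x ∈ X.exitTime ⁻¹' Iio r ↔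
      ∃ a b : ℚ, ((0 : ℝ) < a ∧ (a : ℝ) < b ∧ ENNReal.ofReal b < r) ∧
        ∀ n : ℕ, ∃ c : ℚ, ((a : ℝ) ≤ c ∧ (c : ℝ) ≤ b) ∧
          Metric.infEDist (X.Φ x c) (frontier X.E) < ((n : ℝ≥0∞) + 1)⁻¹ := by
    intro x
    have hcont : Continuous fun t => Metric.infEDist (X.Φ x t) (frontier X.E) :=
      Metric.continuous_infEDist.comp (X.continuous_Φ x)
    rw [mem_preimage, mem_Iio, exitTime_lt_iff]
    constructor
    · rintro ⟨t, ⟨ht0, htF⟩, htr⟩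
      obtain ⟨a, ha0, hat⟩ := exists_rat_btwn ht0
      have hU : ∀ᶠ s in 𝓝[>] t, ENNReal.ofReal s < r :=
        (ENNReal.continuous_ofReal.continuousAt.eventually_lt continuousAt_const htr).filter_mono
          nhdsWithin_le_nhds
      obtain ⟨u, hut, hu⟩ := (mem_nhdsGT_iff_exists_Ioo_subset).1 hU
      obtain ⟨b, htb, hbu⟩ := exists_rat_btwn (show t < u from hut)
      refine ⟨a, b, ⟨ha0, hat.trans htb, hu ⟨htb, hbu⟩⟩, fun n => ?_⟩
      have hV : ∀ᶠ s in 𝓝[>] t, Metric.infEDist (X.Φ x s) (frontier X.E)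
          < ((n : ℝ≥0∞) + 1)⁻¹ := by
        refine (hcont.continuousAt.eventually_lt continuousAt_const ?_).filter_mono
          nhdsWithin_le_nhds
        rw [Metric.infEDist_zero_of_mem htF]
        exact ENNReal.inv_pos.2 (by finiteness)
      obtain ⟨v, hvt, hv⟩ := (mem_nhdsGT_iff_exists_Ioo_subset).1 hV
      obtain ⟨c, htc, hcv⟩ := exists_rat_btwn (lt_min (show t < v from hvt) htb)
      exact ⟨c, ⟨(hat.trans htc).le, (hcv.trans_le (min_le_right _ _)).le⟩,
        hv ⟨htc, hcv.trans_le (min_le_left _ _)⟩⟩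
    · rintro ⟨a, b, ⟨ha0, hab, hbr⟩, h⟩
      obtain ⟨t, ht, hmin⟩ := (isCompact_Icc (a := (a : ℝ)) (b := (b : ℝ))).exists_isMinOn
        ⟨a, left_mem_Icc.2 hab.le⟩ hcont.continuousOn
      refine ⟨t, ⟨ha0.trans_le ht.1, ?_⟩,
        (ENNReal.ofReal_le_ofReal ht.2).trans_lt hbr⟩
      have h0 : Metric.infEDist (X.Φ x t) (frontier X.E) = 0 := by
        by_contra hne
        obtain ⟨n, hn⟩ := ENNReal.exists_inv_nat_lt hne
        obtain ⟨c, hc, hlt⟩ := h n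
        have h1 := (hmin (show (c : ℝ) ∈ Icc (a : ℝ) b from hc)).out.trans_lt hlt
        have h2 : ((n : ℝ≥0∞) + 1)⁻¹ ≤ (n : ℝ≥0∞)⁻¹ := ENNReal.inv_le_inv.2 le_self_add
        exact absurd (h1.trans_le h2) (not_lt.2 hn.le)
      rw [← (isClosed_frontier (s := X.E)).closure_eq]
      exact Metric.mem_closure_iff_infEDist_zero.2 h0
  have hset : X.exitTime ⁻¹' Iio r = ⋃ (a : ℚ) (b : ℚ)
      (_ : (0 : ℝ) < a ∧ (a : ℝ) < b ∧ ENNReal.ofReal b < r), ⋂ n : ℕ, ⋃ (c : ℚ)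
        (_ : (a : ℝ) ≤ c ∧ (c : ℝ) ≤ b),
          {x | Metric.infEDist (X.Φ x c) (frontier X.E) < ((n : ℝ≥0∞) + 1)⁻¹} := by
    ext x
    rw [hmem x]
    simp only [mem_iUnion, mem_iInter, mem_ofPred_eq, exists_prop]
  rw [hset]
  refine MeasurableSet.iUnion fun a => MeasurableSet.iUnion fun b => MeasurableSet.iUnion fun _ =>
    MeasurableSet.iInter fun n => MeasurableSet.iUnion fun c => MeasurableSet.iUnion fun _ => ?_
  have hm : Measurable fun x => X.Φ x c :=
    X.measurable_Φ.comp (measurable_id.prodMk measurable_const)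
  exact measurableSet_lt (Metric.continuous_infEDist.measurable.comp hm) measurable_const

lemma measurable_hazard (t : ℝ) : Measurable fun x => X.hazard x t := by
  have h : Measurable fun p : Space d × ℝ => (X.rate (X.Φ p.1 p.2) : ℝ≥0∞) :=
    (X.measurable_rate.comp X.measurable_Φ).coe_nnreal_ennreal
  exact h.lintegral_prod_right'

lemma hazard_mono (x : Space d) : Monotone (X.hazard x) := fun _ _ h =>
  lintegral_mono_set (Ioo_subset_Ioo_right h)

lemma lt_jumpTime_iff (x : Space d) (e : ℝ) (r : ℝ≥0∞) :
    r < X.jumpTime x e ↔ ∃ t : ℝ, (0 ≤ t ∧ ENNReal.ofReal t < X.exitTime x ∧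
      X.hazard x t < ENNReal.ofReal e) ∧ r < ENNReal.ofReal t := by
  simp only [jumpTime, lt_iSup_iff, exists_prop]

lemma measurable_jumpTime : Measurable fun p : Space d × ℝ => X.jumpTime p.1 p.2 := by
  refine measurable_of_Ioi fun r => ?_
  have hset : (fun p : Space d × ℝ => X.jumpTime p.1 p.2) ⁻¹' Ioi r =
      ⋃ (c : ℚ) (_ : (0 : ℝ) ≤ c ∧ r < ENNReal.ofReal c),
        ({p | ENNReal.ofReal c < X.exitTime p.1} ∩ {p | X.hazard p.1 c < ENNReal.ofReal p.2}) := by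
    ext p
    simp only [mem_preimage, mem_Ioi, lt_jumpTime_iff, mem_iUnion, exists_prop, mem_inter_iff,
      mem_ofPred_eq]
    constructor
    · rintro ⟨t, ⟨ht0, hte, hth⟩, hrt⟩
      have hr : r ≠ ∞ := (hrt.trans ENNReal.ofReal_lt_top).ne
      have hrt' : r.toReal < t := by
        rwa [← ENNReal.ofReal_toReal hr, ENNReal.ofReal_lt_ofReal_iff_of_nonneg
          ENNReal.toReal_nonneg] at hrt
      obtain ⟨c, hrc, hct⟩ := exists_rat_btwn hrt'
      have hc0 : (0 : ℝ) ≤ c := ENNReal.toReal_nonneg.trans hrc.le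
      refine ⟨c, ⟨hc0, ?_⟩, (ENNReal.ofReal_le_ofReal hct.le).trans_lt hte,
        (X.hazard_mono _ hct.le).trans_lt hth⟩
      rwa [← ENNReal.ofReal_toReal hr, ENNReal.ofReal_lt_ofReal_iff_of_nonneg
          ENNReal.toReal_nonneg]
    · rintro ⟨c, ⟨hc0, hrc⟩, h1, h2⟩
      exact ⟨c, ⟨hc0, h1, h2⟩, hrc⟩
  rw [hset]
  refine MeasurableSet.iUnion fun c => MeasurableSet.iUnion fun _ => MeasurableSet.inter ?_ ?_
  · exact measurableSet_lt measurable_const (X.measurable_exitTime.comp measurable_fst)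
  · exact measurableSet_lt ((X.measurable_hazard c).comp measurable_fst)
      (ENNReal.measurable_ofReal.comp measurable_snd)

/-- The kernel `𝒮(x, ·)`: the conditional distribution of the inter-jumping time `S_{n+1}` given
`Z_n = x`, realised as the law of the jump time when the threshold of the integrated rate is a
standard exponential variable. Its survival function is computed in `interJump_Ioi`. -/
def interJump : Kernel (Space d) ℝ :=
  (Kernel.id ×ₖ Kernel.const (Space d) (expMeasure 1)).map
    fun p : Space d × ℝ => (X.jumpTime p.1 p.2).toReal

instance : IsProbabilityMeasure (expMeasure 1) := isProbabilityMeasure_expMeasure one_pos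

instance : IsMarkovKernel X.interJump :=
  Kernel.IsMarkovKernel.map _ X.measurable_jumpTime.ennreal_toReal

/-- The survival function `G(x,t)` of the inter-jumping time from `x`. -/
def survival (x : Space d) (t : ℝ) : ℝ≥0∞ :=
  open Classical in
  if ENNReal.ofReal t < X.exitTime x then EReal.exp (-(X.hazard x t : EReal)) else 0

lemma mem_E_of_lt_exitTime {x : Space d} (hx : x ∈ X.E) {t : ℝ} (ht : 0 ≤ t)
    (h : ENNReal.ofReal t < X.exitTime x) : X.Φ x t ∈ X.E := by
  by_contra hne
  have hF : ∀ s ∈ Icc 0 t, X.Φ x s ∉ frontier X.E := by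
    intro s hs hsF
    have hs0 : 0 < s := by
      rcases hs.1.eq_or_lt with h0 | h0
      · rw [← h0, X.Φ_zero, X.isOpen_E.frontier_eq] at hsF
        exact absurd hx hsF.2
      · exact h0
    exact absurd ((X.exitTime_lt_iff x _).2 ⟨s, ⟨hs0, hsF⟩,
      (ENNReal.ofReal_le_ofReal hs.2).trans_lt h⟩) (lt_irrefl _)
  have hF' : ∀ s ∈ Icc 0 t, X.Φ x s ∉ X.E → X.Φ x s ∈ (closure X.E)ᶜ := by
    intro s hs hsE hcl
    refine hF s hs ?_
    rw [X.isOpen_E.frontier_eq]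
    exact ⟨hcl, hsE⟩
  have hconn : IsPreconnected (X.Φ x '' Icc 0 t) :=
    isPreconnected_Icc.image _ (X.continuous_Φ x).continuousOn
  obtain ⟨y, -, hy1, hy2⟩ := hconn X.E (closure X.E)ᶜ X.isOpen_E isClosed_closure.isOpen_compl
    (by
      rintro _ ⟨s, hs, rfl⟩
      by_cases hsE : X.Φ x s ∈ X.E
      · exact Or.inl hsE
      · exact Or.inr (hF' s hs hsE))
    ⟨x, ⟨0, left_mem_Icc.2 ht, X.Φ_zero x⟩, hx⟩
    ⟨_, ⟨t, right_mem_Icc.2 ht, rfl⟩, hF' t (right_mem_Icc.2 ht) hne⟩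
  exact hy2 (subset_closure hy1)

lemma hazard_add_le (x : Space d) (t u : ℝ) :
    X.hazard x (t + u) ≤ X.hazard x t + X.hazard (X.Φ x t) u := by
  have hsub : Ioo (0 : ℝ) (t + u) ⊆ Ioo 0 t ∪ Ico t (t + u) := by
    intro s hs
    rcases lt_or_ge s t with h | h
    · exact Or.inl ⟨hs.1, h⟩
    · exact Or.inr ⟨h, hs.2⟩
  refine (lintegral_mono_set hsub).trans ((lintegral_union_le _ _ _).trans ?_)
  refine add_le_add le_rfl (le_of_eq ?_)
  have hm : Measurable fun s => (X.rate (X.Φ x s) : ℝ≥0∞) :=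
    (X.measurable_rate.comp (X.continuous_Φ x).measurable).coe_nnreal_ennreal
  have hpre : (fun s : ℝ => t + s) ⁻¹' Ico t (t + u) = Ico 0 u := by
    ext s
    simp
  rw [← (measurePreserving_add_left volume t).setLIntegral_comp_preimage measurableSet_Ico hm,
    hpre, hazard, setLIntegral_congr Ioo_ae_eq_Ico]
  simp only [X.Φ_add]

lemma lt_jumpTime_iff_of_mem {x : Space d} (hx : x ∈ X.E) {t : ℝ} (ht : 0 ≤ t) (e : ℝ) :
    ENNReal.ofReal t < X.jumpTime x e ↔
      ENNReal.ofReal t < X.exitTime x ∧ X.hazard x t < ENNReal.ofReal e := by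
  rw [lt_jumpTime_iff]
  constructor
  · rintro ⟨s, ⟨-, h1, h2⟩, hts⟩
    have hle : t ≤ s := by
      by_contra hlt
      exact absurd hts (not_lt.2 (ENNReal.ofReal_le_ofReal (not_le.1 hlt).le))
    exact ⟨hts.trans h1, (X.hazard_mono x hle).trans_lt h2⟩
  · rintro ⟨h1, h2⟩
    obtain ⟨ε, hε, hint⟩ := X.rate_integrable _ (X.mem_E_of_lt_exitTime hx ht h1)
    have hlim : Tendsto (fun u => X.hazard (X.Φ x t) u) (𝓝[>] 0) (𝓝 0) := by
      have hvol : Tendsto (volume.restrict (Ioo (0 : ℝ) ε) ∘ fun u => Ioo (0 : ℝ) u)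
          (𝓝[>] 0) (𝓝 0) := by
        refine tendsto_of_tendsto_of_tendsto_of_le_of_le' tendsto_const_nhds
          (h := fun u => ENNReal.ofReal u) ?_ (Eventually.of_forall fun _ => zero_le) ?_
        · have := (ENNReal.continuous_ofReal.tendsto (0 : ℝ))
          rw [ENNReal.ofReal_zero] at this
          exact this.mono_left nhdsWithin_le_nhds
        · refine Eventually.of_forall fun u => ?_
          refine (Measure.restrict_apply_le _ _).trans ?_
          rw [Real.volume_Ioo, sub_zero]
      refine (tendsto_setLIntegral_zero hint.ne hvol).congr' ?_
      filter_upwards [Ioo_mem_nhdsGT hε] with u hu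
      rw [Measure.restrict_restrict measurableSet_Ioo, hazard,
        inter_eq_left.2 (Ioo_subset_Ioo_right hu.2.le)]
    have h3 : ∀ᶠ u in 𝓝[>] (0 : ℝ), X.hazard x t + X.hazard (X.Φ x t) u < ENNReal.ofReal e := by
      have := hlim.const_add (X.hazard x t)
      rw [add_zero] at this
      exact this.eventually_lt_const h2
    have h4 : ∀ᶠ u in 𝓝[>] (0 : ℝ), ENNReal.ofReal (t + u) < X.exitTime x := by
      have hc : Continuous fun u : ℝ => ENNReal.ofReal (t + u) :=
        ENNReal.continuous_ofReal.comp (continuous_const.add continuous_id)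
      exact (hc.continuousAt.eventually_lt continuousAt_const (by simpa using h1)).filter_mono
        nhdsWithin_le_nhds
    obtain ⟨u, hu3, hu4, hu0⟩ := (h3.and (h4.and self_mem_nhdsWithin)).exists
    have hu0' : 0 < u := hu0
    refine ⟨t + u, ⟨by linarith, hu4, (X.hazard_add_le x t u).trans_lt hu3⟩, ?_⟩
    exact (ENNReal.ofReal_lt_ofReal_iff (by linarith)).2 (by linarith)

lemma jumpTime_ne_top {x : Space d} (hx : x ∈ X.E) (e : ℝ) : X.jumpTime x e ≠ ∞ := by
  by_cases hex : ∃ t > 0, X.Φ x t ∈ frontier X.E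
  · obtain ⟨t, ht, htF⟩ := hex
    have h1 : X.exitTime x ≤ ENNReal.ofReal t := iInf₂_le t ⟨ht, htF⟩
    refine ne_top_of_le_ne_top (h1.trans_lt ENNReal.ofReal_lt_top).ne ?_
    exact iSup₂_le fun s hs => hs.2.1.le
  · push Not at hex
    have hinf := X.jump_finite x hx hex
    have hU : (⋃ n : ℕ, Ioo (0 : ℝ) n) = Ioi 0 := by
      ext s
      simp only [mem_iUnion, mem_Ioo, mem_Ioi]
      constructor
      · rintro ⟨n, h, -⟩
        exact h
      · intro h
        obtain ⟨n, hn⟩ := exists_nat_gt s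
        exact ⟨n, h, hn⟩
    rw [← hU, setLIntegral_iUnion_of_directed _ (directed_of_isDirected_le fun m n hmn =>
      Ioo_subset_Ioo_right (by exact_mod_cast hmn))] at hinf
    have hlt : ENNReal.ofReal e < ⨆ n : ℕ, X.hazard x n := by
      have : (⨆ n : ℕ, X.hazard x n) = ∞ := hinf
      rw [this]
      exact ENNReal.ofReal_lt_top
    obtain ⟨n, hn⟩ := lt_iSup_iff.1 hlt
    refine ne_top_of_le_ne_top (ENNReal.ofReal_ne_top (r := (n : ℝ))) ?_
    refine iSup₂_le fun s hs => ENNReal.ofReal_le_ofReal ?_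
    by_contra hlt
    exact absurd (hs.2.2.trans hn) (not_lt.2 (X.hazard_mono x (not_le.1 hlt).le))

lemma expMeasure_lt (h : ℝ≥0∞) :
    expMeasure 1 {e : ℝ | h < ENNReal.ofReal e} = EReal.exp (-(h : EReal)) := by
  induction h with
  | top => simp
  | coe r =>
    have hset : {e : ℝ | (r : ℝ≥0∞) < ENNReal.ofReal e} = (Iic (r : ℝ))ᶜ := by
      ext e
      rw [mem_ofPred_eq, mem_compl_iff, mem_Iic, not_le, ← ENNReal.ofReal_coe_nnreal,
        ENNReal.ofReal_lt_ofReal_iff_of_nonneg r.coe_nonneg]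
    rw [hset, prob_compl_eq_one_sub measurableSet_Iic, ← ofReal_cdf,
      cdf_expMeasure_eq one_pos, if_pos r.coe_nonneg, one_mul, ← ENNReal.ofReal_one,
      ← ENNReal.ofReal_sub _ (by simp)]
    have : (-((r : ℝ≥0∞) : EReal)) = ((-(r : ℝ) : ℝ) : EReal) := rfl
    rw [this, EReal.exp_coe, sub_sub_cancel]

/-- The survival function of the inter-jumping times: `𝒮(x, (t, ∞))` is `exp (-∫₀ᵗ λ(Φ(x,s)) ds)`
before the exit time and `0` afterwards. -/
theorem interJump_Ioi {x : Space d} (hx : x ∈ X.E) {t : ℝ} (ht : 0 ≤ t) :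
    X.interJump x (Ioi t) = X.survival x t := by
  have hm := X.measurable_jumpTime.ennreal_toReal
  have h1 : X.interJump x (Ioi t) = expMeasure 1 {e | t < (X.jumpTime x e).toReal} := by
    rw [interJump, Kernel.map_apply' _ hm _ measurableSet_Ioi, Kernel.prod_apply,
      Kernel.id_apply, Kernel.const_apply, Measure.dirac_prod,
      Measure.map_apply (by fun_prop) (hm measurableSet_Ioi)]
    rfl
  have h2 : {e | t < (X.jumpTime x e).toReal} =
      {e | ENNReal.ofReal t < X.exitTime x ∧ X.hazard x t < ENNReal.ofReal e} := by
    ext e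
    rw [mem_ofPred_eq, mem_ofPred_eq, ← X.lt_jumpTime_iff_of_mem hx ht,
      ENNReal.ofReal_lt_iff_lt_toReal ht (X.jumpTime_ne_top hx e)]
  rw [h1, h2, survival]
  split_ifs with h
  · simp only [h, true_and]
    exact expMeasure_lt _
  · simp [h]

/-- The Markov kernel `𝒫` of the post-jump locations,
`𝒫(x, A) = ∫ 𝒮(x, dt) 𝒬(Φ(x,t), A)`. -/
def postJump : Kernel (Space d) (Space d) :=
  (X.Q.comap (Function.uncurry X.Φ) X.measurable_Φ) ∘ₖ (Kernel.id ×ₖ X.interJump)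

instance : IsMarkovKernel X.postJump := by
  unfold postJump
  infer_instance

instance (n : ℕ) : IsMarkovKernel (X.postJump ^ n) := by
  induction n with
  | zero => exact (inferInstance : IsMarkovKernel (Kernel.id : Kernel (Space d) (Space d)))
  | succ n ih =>
    rw [Kernel.pow_add]
    have : IsMarkovKernel (X.postJump ^ 1) := by
      rw [pow_one]
      infer_instance
    infer_instance

lemma postJump_apply (x : Space d) {A : Set (Space d)} (hA : MeasurableSet A) :
    X.postJump x A = ∫⁻ t, X.Q (X.Φ x t) A ∂(X.interJump x) := by
  have hm : Measurable fun p : Space d × ℝ => X.Q (X.Φ p.1 p.2) A :=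
    (X.Q.measurable_coe hA).comp X.measurable_Φ
  rw [postJump, Kernel.comp_apply' _ _ _ hA, Kernel.prod_apply, Kernel.id_apply,
    Measure.dirac_prod, lintegral_map _ (by fun_prop)]
  · rfl
  · exact hm

/-- The Markov kernel `ℛ` of the chain `(Z_n, S_{n+1})`,
`ℛ((x,t), A × B) = ∫_A 𝒬(Φ(x,t), dξ) 𝒮(ξ, B)`. -/
def pairKernel : Kernel (Space d × ℝ) (Space d × ℝ) :=
  (X.Q.comap (Function.uncurry X.Φ) X.measurable_Φ) ⊗ₖ
    (X.interJump.comap (fun p : (Space d × ℝ) × Space d => p.2) measurable_snd)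

/-- `(Z_n)` and `(S_{n+1})` are the post-jump locations and the inter-jumping times of the
process started from some initial distribution on `E` (the law of `Z_0`): given `Z_0`, the time
`S_1` has law `𝒮(Z_0, ·)`, and `(Z_n, S_{n+1})` is a Markov chain with kernel `ℛ`, i.e. the
conditional law of `(Z_{n+1}, S_{n+2})` given `(Z_0, S_1), …, (Z_n, S_{n+1})` is
`ℛ((Z_n, S_{n+1}), ·)`. The variable `S 0` plays no role. -/
structure IsEmbeddedChain {Ω : Type*} [MeasurableSpace Ω] (P : Measure Ω)
    (Z : ℕ → Ω → Space d) (S : ℕ → Ω → ℝ) : Prop where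
  measurable_Z : ∀ n, Measurable (Z n)
  measurable_S : ∀ n, Measurable (S (n + 1))
  initial_mem : ∀ᵐ ω ∂P, Z 0 ω ∈ X.E
  initial_time : HasCondDistrib (S 1) (Z 0) X.interJump P
  transition : ∀ n : ℕ, HasCondDistrib (fun ω => (Z (n + 1) ω, S (n + 2) ω))
    (fun ω (i : Fin (n + 1)) => (Z i ω, S (i + 1) ω))
    (X.pairKernel.comap (fun h : Fin (n + 1) → Space d × ℝ => h (Fin.last n))
      (measurable_pi_apply _)) P

/-- The class `𝒞` of the sets `C × [0,T]` with `C` a compact subset of `E` and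
`T < inf_{x ∈ C} t⁺(x)`. -/
def rectangles : Set (Set (Space d × ℝ)) :=
  {D | ∃ (C : Set (Space d)) (T : ℝ), IsCompact C ∧ C ⊆ X.E ∧ 0 ≤ T ∧
    ENNReal.ofReal T < ⨅ x ∈ C, X.exitTime x ∧ D = C ×ˢ Icc 0 T}

end PDMP

/-- The total variation norm `‖μ - ν‖_TV` of the difference of two finite measures. -/
def tvNorm {V : Type*} [MeasurableSpace V] (μ ν : Measure V) [IsFiniteMeasure μ]
    [IsFiniteMeasure ν] : ℝ :=
  (μ.toSignedMeasure - ν.toSignedMeasure).totalVariation.real univ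

/-- The kernel functions used for smoothing: nonnegative, continuous, bounded, of integral `1`,
and supported in the ball of radius `δ` centred at the origin. -/
structure IsSmoothingKernel {V : Type*} [NormedAddCommGroup V] [MeasureSpace V] (K : V → ℝ)
    (δ : ℝ) : Prop where
  nonneg : ∀ u, 0 ≤ K u
  continuous : Continuous K
  bounded : ∃ c, ∀ u, K u ≤ c
  integral_eq_one : ∫ u, K u = 1
  support_subset : Function.support K ⊆ Metric.closedBall 0 δ

/-- The bandwidth sequence `v_k = v₀ (k+1)^{-α}`. -/
def bandwidth (v₀ α : ℝ) (k : ℕ) : ℝ := v₀ * ((k : ℝ) + 1) ^ (-α)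

section Estimators

variable {d : ℕ} {Ω : Type*} (Kd : Space d → ℝ) (K1 : ℝ → ℝ) (v₀ w₀ α β : ℝ)
  (Z : ℕ → Ω → Space d) (S : ℕ → Ω → ℝ)

/-- The estimator `F̂ⁿ(x,t)`. -/
def estF (n : ℕ) (x : Space d) (t : ℝ) (ω : Ω) : ℝ :=
  (1 / (n : ℝ)) * ∑ i ∈ Finset.range n,
    (1 / (bandwidth v₀ α i ^ d * bandwidth w₀ β i)) *
      Kd ((bandwidth v₀ α i)⁻¹ • (Z i ω - x)) * K1 ((S (i + 1) ω - t) / bandwidth w₀ β i)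

/-- The estimator `Ĝⁿ(x,t)`. -/
def estG (n : ℕ) (x : Space d) (t : ℝ) (ω : Ω) : ℝ :=
  (1 / (n : ℝ)) * ∑ i ∈ Finset.range n,
    (1 / bandwidth v₀ α i ^ d) * Kd ((bandwidth v₀ α i)⁻¹ • (Z i ω - x)) *
      (Ioi t).indicator 1 (S (i + 1) ω)

/-- The estimator `ν̂ⁿ_∞(x)`. -/
def estNu (n : ℕ) (x : Space d) (ω : Ω) : ℝ :=
  (1 / (n : ℝ)) * ∑ i ∈ Finset.range n,
    (1 / bandwidth v₀ α i ^ d) * Kd ((bandwidth v₀ α i)⁻¹ • (Z i ω - x))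

end Estimators

end

/-! Each estimator is an average of `n` functions of the pairs `(Z_i, S_{i+1})`, and the bandwidths
bound these functions by `B` of order `n^(αd+β)` or `n^(αd)`, uniformly in `(x,t)`. It therefore
suffices that such averages have variance `O(B²/n)`, which follows once the covariances of functions
bounded by `1` are summable (`IsEmbeddedChain.exists_variance_average_le`).

By the Markov property the covariance of a function at time `i` and one at time `i+1+k` is at most
twice the mean of `|𝒫^k g - ∫ g dν_∞|` at `Z_{i+1}` (`IsEmbeddedChain.abs_covariance_le`). The law
of `Z_{i+1}` may be replaced by `ν_∞` at a cost that is geometric in `i`. What remains is a summable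
bound in `k` for `∫ |𝒫^k g - ∫ g dν_∞| dν_∞`, uniform in `g`.

The constant of ergodicity depends on the starting point and need not be integrable. It is however
bounded by some `N` on a set `A` of positive stationary mass (`exists_ergodicOn`). A stationary
trajectory either meets `A` within `k/2` steps, after which at least `k/2` steps of uniform
geometric convergence remain, or avoids `A` during that time. The probabilities of avoidance are
summable (`ErgodicOn.summable_taboo`): comparing the last-visit decomposition under the stationary
law with the one restricted to `A` gives a renewal inequality, and `summable_of_renewal_bound`
solves it. Together this is `ErgodicOn.exists_summable_rate`. -/

/-! ### A renewal inequality for real sequences -/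

/-- A renewal-type inequality with geometrically small errors forces the tails `H` to be
summable. -/
theorem summable_of_renewal_bound {H Δ : ℕ → ℝ} {p N r : ℝ} (hp : 0 < p) (hN : 0 ≤ N)
    (hr0 : 0 ≤ r) (hr1 : r < 1) (hΔ : ∀ n, 0 ≤ Δ n) (hH : ∀ n, 0 ≤ H n)
    (hrec : ∀ n, H n = H (n + 1) + Δ n)
    (hbd : ∀ n, p * H (n + 1) ≤ ∑ k ∈ Finset.range (n + 1), min (Δ (n - k)) (N * r ^ k)) :
    Summable H := by
  -- The integer `q` is the slope at which the double sum is cut; `1/q ≤ p/2` lets half of the left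
  -- side absorb one of the two pieces.
  obtain ⟨q, hq⟩ := exists_nat_gt (2 / p)
  have hq0 : (0 : ℝ) < q := (by positivity : (0 : ℝ) < 2 / p).trans hq
  have hq0' : 0 < q := by exact_mod_cast hq0
  have hqp : (1 : ℝ) / q ≤ p / 2 := by
    rw [div_le_div_iff₀ hq0 two_pos]
    rw [div_lt_iff₀ hp] at hq
    linarith
  have hsum : Summable fun k : ℕ => (q : ℝ) * ((k : ℝ) + 1) * (N * r ^ k) := by
    have h1 : Summable fun k : ℕ => (k : ℝ) ^ 1 * r ^ k :=
      summable_pow_mul_geometric_of_norm_lt_one 1 (by rwa [Real.norm_of_nonneg hr0])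
    have h2 := summable_geometric_of_lt_one hr0 hr1
    refine ((h1.add h2).mul_left (q * N)).congr fun k => ?_
    ring
  -- Summation by parts, with the boundary term kept, since `H` is not known to tend to `0`.
  have hparts : ∀ L : ℕ, ∑ m ∈ Finset.range L, (m : ℝ) * Δ m + L * H L
      = ∑ n ∈ Finset.range L, H (n + 1) := by
    intro L
    induction L with
    | zero => simp
    | succ L ih =>
      rw [Finset.sum_range_succ, Finset.sum_range_succ, ← ih, hrec L]
      push_cast
      ring
  have hmain : ∀ L : ℕ, ∑ n ∈ Finset.range L, H (n + 1)
      ≤ 2 / p * ∑' k : ℕ, (q : ℝ) * ((k : ℝ) + 1) * (N * r ^ k) := by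
    intro L
    have h1 : p * ∑ n ∈ Finset.range L, H (n + 1) ≤
        ∑ k ∈ Finset.range L, ∑ m ∈ Finset.range L, min (Δ m) (N * r ^ k) := by
      rw [Finset.mul_sum]
      refine (Finset.sum_le_sum fun n _ => hbd n).trans ?_
      rw [Finset.sum_range_diag_flip L fun k m => min (Δ m) (N * r ^ k)]
      refine Finset.sum_le_sum fun k _ => ?_
      refine Finset.sum_le_sum_of_subset_of_nonneg
        (Finset.range_subset_range.2 (Nat.sub_le _ _)) fun m _ _ => ?_
      exact le_min (hΔ m) (by positivity)
    -- Below the line `k = m / q` the bound `Δ m` is used, for at most `m / q` values of `k`; on and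
    -- above it the geometric bound is used, for at most `q * (k + 1)` values of `m`.
    have h2 : ∀ k m : ℕ, min (Δ m) (N * r ^ k) ≤
        (if k < m / q then Δ m else 0) + (if m < q * (k + 1) then N * r ^ k else 0) := by
      intro k m
      by_cases h : k < m / q
      · rw [if_pos h]
        refine (min_le_left _ _).trans (le_add_of_nonneg_right ?_)
        split_ifs
        · positivity
        · exact le_rfl
      · have h' : m < q * (k + 1) := by
          rw [not_lt] at h
          have := (Nat.div_lt_iff_lt_mul hq0').1 (Nat.lt_succ_of_le h)
          rwa [mul_comm]
        rw [if_neg h, if_pos h', zero_add]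
        exact min_le_right _ _
    have h3 : ∑ k ∈ Finset.range L, ∑ m ∈ Finset.range L, (if k < m / q then Δ m else 0)
        ≤ p / 2 * ∑ n ∈ Finset.range L, H (n + 1) := by
      rw [Finset.sum_comm]
      have : ∀ m ∈ Finset.range L, ∑ k ∈ Finset.range L, (if k < m / q then Δ m else 0)
          ≤ p / 2 * (m * Δ m) := by
        intro m _
        rw [← Finset.sum_filter, Finset.sum_const, nsmul_eq_mul]
        have hcard : ((Finset.range L).filter fun k => k < m / q).card ≤ m / q := by
          refine (Finset.card_le_card (t := Finset.range (m / q)) fun k hk => ?_).trans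
            (Finset.card_range _).le
          exact Finset.mem_range.2 (Finset.mem_filter.1 hk).2
        have hc : (((Finset.range L).filter fun k => k < m / q).card : ℝ) ≤ p / 2 * m := by
          calc (((Finset.range L).filter fun k => k < m / q).card : ℝ)
              ≤ ((m / q : ℕ) : ℝ) := by exact_mod_cast hcard
            _ ≤ (m : ℝ) / q := Nat.cast_div_le
            _ = 1 / q * m := by ring
            _ ≤ p / 2 * m := by gcongr
        calc _ ≤ p / 2 * m * Δ m := mul_le_mul_of_nonneg_right hc (hΔ m)
          _ = _ := by ring
      refine (Finset.sum_le_sum this).trans ?_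
      rw [← Finset.mul_sum]
      refine mul_le_mul_of_nonneg_left ?_ (by positivity)
      rw [← hparts L]
      exact le_add_of_nonneg_right (mul_nonneg (Nat.cast_nonneg _) (hH L))
    have h4 : ∑ k ∈ Finset.range L, ∑ m ∈ Finset.range L,
        (if m < q * (k + 1) then N * r ^ k else 0)
        ≤ ∑' k : ℕ, (q : ℝ) * ((k : ℝ) + 1) * (N * r ^ k) := by
      refine le_trans (Finset.sum_le_sum fun k _ => ?_)
        (hsum.sum_le_tsum (Finset.range L) fun k _ => by positivity)
      rw [← Finset.sum_filter, Finset.sum_const, nsmul_eq_mul]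
      refine mul_le_mul_of_nonneg_right ?_ (by positivity)
      have hcard : ((Finset.range L).filter fun m => m < q * (k + 1)).card ≤ q * (k + 1) := by
        refine (Finset.card_le_card (t := Finset.range (q * (k + 1))) fun m hm => ?_).trans
          (Finset.card_range _).le
        exact Finset.mem_range.2 (Finset.mem_filter.1 hm).2
      exact_mod_cast hcard
    have h5 : ∑ k ∈ Finset.range L, ∑ m ∈ Finset.range L, min (Δ m) (N * r ^ k) ≤
        ∑ k ∈ Finset.range L, ∑ m ∈ Finset.range L, (if k < m / q then Δ m else 0) +
        ∑ k ∈ Finset.range L, ∑ m ∈ Finset.range L,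
          (if m < q * (k + 1) then N * r ^ k else 0) := by
      rw [← Finset.sum_add_distrib]
      refine Finset.sum_le_sum fun k _ => ?_
      rw [← Finset.sum_add_distrib]
      exact Finset.sum_le_sum fun m _ => h2 k m
    -- The term `p / 2 * ∑ H` moves to the left; this is legitimate because all sums are still
    -- finite, and the resulting bound is free of `L`.
    rw [div_mul_eq_mul_div, le_div_iff₀ hp]
    linarith
  exact (summable_nat_add_iff 1).1
    (summable_of_sum_range_le (fun n => hH (n + 1)) hmain)

/-! ### Total variation and integrals of bounded functions -/

section TotalVariation

variable {V : Type*} [MeasurableSpace V]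

/-- The Jordan parts of `μ - ν` balance the two measures. -/
theorem add_jordan_negPart_eq (μ ν : Measure V) [IsFiniteMeasure μ] [IsFiniteMeasure ν] :
    μ + (μ.toSignedMeasure - ν.toSignedMeasure).toJordanDecomposition.negPart =
      ν + (μ.toSignedMeasure - ν.toSignedMeasure).toJordanDecomposition.posPart := by
  set s := μ.toSignedMeasure - ν.toSignedMeasure with hs
  refine Measure.ext fun A hA => ?_
  have h := s.apply_eq_posPart_real_sub_negPart_real hA
  have h' : s A = μ.real A - ν.real A := by
    rw [hs]
    simp [Measure.toSignedMeasure_apply_measurable hA]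
  rw [h'] at h
  have h2 : (μ + s.toJordanDecomposition.negPart).real A
      = (ν + s.toJordanDecomposition.posPart).real A := by
    rw [measureReal_add_apply, measureReal_add_apply]
    linarith
  exact (measureReal_eq_measureReal_iff).1 h2

/-- The balance of the Jordan parts turns the difference into an integral against the positive part
minus one against the negative part. The factor is `B`, not `2 * B`, because `tvNorm` is the sum of
both masses. -/
theorem abs_integral_sub_le_tvNorm (μ ν : Measure V) [IsFiniteMeasure μ] [IsFiniteMeasure ν]
    {g : V → ℝ} (hg : Measurable g) {B : ℝ} (hB : ∀ x, |g x| ≤ B) :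
    |∫ x, g x ∂μ - ∫ x, g x ∂ν| ≤ B * tvNorm μ ν := by
  set s := μ.toSignedMeasure - ν.toSignedMeasure with hs
  have hint : ∀ (ρ : Measure V) [IsFiniteMeasure ρ], Integrable g ρ := fun ρ _ =>
    Integrable.of_bound hg.aestronglyMeasurable B (Eventually.of_forall hB)
  have h := congrArg (fun ρ : Measure V => ∫ x, g x ∂ρ) (add_jordan_negPart_eq μ ν)
  simp only [← hs] at h
  rw [integral_add_measure (hint _) (hint _), integral_add_measure (hint _) (hint _)] at h
  have hb : ∀ (ρ : Measure V) [IsFiniteMeasure ρ], |∫ x, g x ∂ρ| ≤ B * ρ.real univ :=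
    fun ρ _ => by
      rw [← Real.norm_eq_abs]
      exact norm_integral_le_of_norm_le_const (Eventually.of_forall hB)
  have h1 := abs_le.1 (hb s.toJordanDecomposition.posPart)
  have h2 := abs_le.1 (hb s.toJordanDecomposition.negPart)
  have ht : tvNorm μ ν = s.toJordanDecomposition.posPart.real univ
      + s.toJordanDecomposition.negPart.real univ := by
    rw [tvNorm, SignedMeasure.totalVariation, measureReal_add_apply]
  rw [ht, abs_le]
  constructor <;> linarith [h1.1, h1.2, h2.1, h2.2]

theorem tvNorm_nonneg (μ ν : Measure V) [IsFiniteMeasure μ] [IsFiniteMeasure ν] :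
    0 ≤ tvNorm μ ν := measureReal_nonneg

end TotalVariation

/-! ### Chains killed on a set, and the last-visit decomposition -/

namespace MarkovChain

variable {V : Type*} [MeasurableSpace V] {κ : Kernel V V} {A : Set V} {π : Measure V}

/-- `taboo κ A f n x` is the expectation of `f (X_n)` on the event that `X_0, …, X_{n-1}` avoid
`A`, for the Markov chain with kernel `κ` started from `x`. -/
noncomputable def taboo (κ : Kernel V V) (A : Set V) (f : V → ℝ≥0∞) : ℕ → V → ℝ≥0∞
  | 0 => f
  | n + 1 => Aᶜ.indicator fun x => ∫⁻ y, taboo κ A f n y ∂κ x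

theorem measurable_taboo (hA : MeasurableSet A) {f : V → ℝ≥0∞} (hf : Measurable f) (n : ℕ) :
    Measurable (taboo κ A f n) := by
  induction n with
  | zero => exact hf
  | succ n ih => exact (ih.lintegral_kernel).indicator hA.compl

theorem taboo_mono {f g : V → ℝ≥0∞} (hfg : ∀ x, f x ≤ g x) (n : ℕ) (x : V) :
    taboo κ A f n x ≤ taboo κ A g n x := by
  induction n generalizing x with
  | zero => exact hfg x
  | succ n ih => exact indicator_le_indicator (lintegral_mono ih)

theorem taboo_add (hA : MeasurableSet A) {f g : V → ℝ≥0∞} (hf : Measurable f) (n : ℕ) (x : V) :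
    taboo κ A (fun y => f y + g y) n x = taboo κ A f n x + taboo κ A g n x := by
  induction n generalizing x with
  | zero => rfl
  | succ n ih =>
    simp only [taboo, indicator]
    split_ifs
    · simp only [ih]
      exact lintegral_add_left (measurable_taboo hA hf n) _
    · simp

theorem taboo_const_mul (hA : MeasurableSet A) {f : V → ℝ≥0∞} (hf : Measurable f) (c : ℝ≥0∞)
    (n : ℕ) (x : V) : taboo κ A (fun y => c * f y) n x = c * taboo κ A f n x := by
  induction n generalizing x with
  | zero => rfl
  | succ n ih =>
    simp only [taboo, indicator]
    split_ifs
    · simp only [ih]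
      exact lintegral_const_mul _ (measurable_taboo hA hf n)
    · simp

/-- The definition peels off the first step of the killed chain; here the last one is peeled off, as
the first-visit decomposition requires. -/
theorem taboo_succ' (f : V → ℝ≥0∞) (n : ℕ) :
    taboo κ A f (n + 1) = taboo κ A (taboo κ A f 1) n := by
  induction n with
  | zero => rfl
  | succ n ih =>
    conv_lhs => rw [taboo]
    conv_rhs => rw [taboo]
    rw [ih]

theorem taboo_le_one [IsMarkovKernel κ] {f : V → ℝ≥0∞} (hf : ∀ x, f x ≤ 1) (n : ℕ) (x : V) :
    taboo κ A f n x ≤ 1 := by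
  induction n generalizing x with
  | zero => exact hf x
  | succ n ih =>
    refine (indicator_le_self' (fun _ _ => zero_le) x).trans ?_
    exact (lintegral_mono ih).trans (by simp)

theorem lintegral_pow_succ (k : ℕ) (x : V) {f : V → ℝ≥0∞} (hf : Measurable f) :
    ∫⁻ y, f y ∂(κ ^ (k + 1)) x = ∫⁻ y, ∫⁻ z, f z ∂(κ ^ k) y ∂κ x := by
  rw [Kernel.pow_add, pow_one, Kernel.lintegral_comp _ _ _ hf]

theorem lintegral_pow_zero (x : V) {f : V → ℝ≥0∞} (hf : Measurable f) :
    ∫⁻ y, f y ∂(κ ^ 0) x = f x := by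
  have : (κ ^ 0) x = Measure.dirac x := by
    rw [pow_zero]
    exact Kernel.id_apply x
  rw [this, lintegral_dirac' x hf]

theorem lintegral_lintegral_of_invariant (h : Kernel.Invariant κ π) {f : V → ℝ≥0∞}
    (hf : Measurable f) : ∫⁻ x, ∫⁻ y, f y ∂κ x ∂π = ∫⁻ x, f x ∂π := by
  conv_rhs => rw [← h.def]
  rw [Measure.lintegral_bind κ.aemeasurable hf.aemeasurable]

theorem lintegral_pow_of_invariant (h : Kernel.Invariant κ π) {f : V → ℝ≥0∞}
    (hf : Measurable f) (k : ℕ) : ∫⁻ x, ∫⁻ y, f y ∂(κ ^ k) x ∂π = ∫⁻ x, f x ∂π := by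
  induction k with
  | zero => simp only [lintegral_pow_zero _ hf]
  | succ k ih =>
    simp only [lintegral_pow_succ _ _ hf]
    rw [lintegral_lintegral_of_invariant h hf.lintegral_kernel, ih]

/-- Forgetting the avoidance of `A` leaves the stationary mean of `f`. -/
theorem lintegral_taboo_le (h : Kernel.Invariant κ π) (hA : MeasurableSet A) {f : V → ℝ≥0∞}
    (hf : Measurable f) (n : ℕ) : ∫⁻ x, taboo κ A f n x ∂π ≤ ∫⁻ x, f x ∂π := by
  induction n with
  | zero => rfl
  | succ n ih =>
    refine le_trans (lintegral_mono fun x => indicator_le_self' (fun _ _ => zero_le) x) ?_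
    rw [lintegral_lintegral_of_invariant h (measurable_taboo hA hf n)]
    exact ih

/-- The mass that leaves `A` from `x ∈ A` and then avoids `A` for `n` further steps. -/
noncomputable def escape (κ : Kernel V V) (A : Set V) (n : ℕ) : V → ℝ≥0∞ :=
  A.indicator fun x => ∫⁻ y, taboo κ A 1 n y ∂κ x

theorem measurable_escape (hA : MeasurableSet A) (n : ℕ) : Measurable (escape κ A n) :=
  ((measurable_taboo hA measurable_one n).lintegral_kernel).indicator hA

theorem escape_le_one [IsMarkovKernel κ] (n : ℕ) (x : V) : escape κ A n x ≤ 1 := by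
  refine (indicator_le_self' (fun _ _ => zero_le) x).trans ?_
  exact (lintegral_mono fun y => taboo_le_one (fun _ => le_rfl) n y).trans (by simp)

/-- The start lies in `A` or outside it. Integrated against an invariant law, this makes the
stationary mass of `escape κ A n` the decrement of the avoidance probability. -/
theorem escape_add_taboo (n : ℕ) (x : V) :
    escape κ A n x + taboo κ A 1 (n + 1) x = ∫⁻ y, taboo κ A 1 n y ∂κ x :=
  congrFun (indicator_self_add_compl A _) x

/-- Decomposition with respect to the last visit of `A` before time `n`. -/
theorem sum_escape_add_taboo [IsMarkovKernel κ] (hA : MeasurableSet A) (n : ℕ) (x : V) :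
    ∑ k ∈ Finset.range n, ∫⁻ y, escape κ A (n - 1 - k) y ∂(κ ^ k) x + taboo κ A 1 n x = 1 := by
  induction n generalizing x with
  | zero => simp [taboo]
  | succ n ih =>
    -- The term `k = 0`, a last visit at time `0`, is split off; every other term is the
    -- decomposition for `n` started after one step.
    rw [Finset.sum_range_succ', lintegral_pow_zero _ (measurable_escape hA _), add_assoc]
    have h0 : n + 1 - 1 - 0 = n := by omega
    rw [h0, escape_add_taboo]
    have h1 : ∀ k ∈ Finset.range n, ∫⁻ y, escape κ A (n + 1 - 1 - (k + 1)) y ∂(κ ^ (k + 1)) x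
        = ∫⁻ y, ∫⁻ z, escape κ A (n - 1 - k) z ∂(κ ^ k) y ∂κ x := by
      intro k _
      have : n + 1 - 1 - (k + 1) = n - 1 - k := by omega
      rw [this, lintegral_pow_succ _ _ (measurable_escape hA _)]
    rw [Finset.sum_congr rfl h1, ← lintegral_finsetSum _ fun k _ =>
      (measurable_escape hA _).lintegral_kernel, ← lintegral_add_right _
      (measurable_taboo hA measurable_one n)]
    simp only [ih]
    simp

/-! ### Summable avoidance probabilities and the mixing rate under the stationary law -/

/-- The chain with kernel `κ` converges to `π` at rate `N * r ^ k` from almost every starting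
point of `A`, uniformly over test functions. -/
def ErgodicOn (κ : Kernel V V) (π : Measure V) (A : Set V) (N r : ℝ) : Prop :=
  ∀ g : V → ℝ, Measurable g → (∀ x, |g x| ≤ 1) → ∀ k : ℕ,
    ∀ᵐ x ∂π, x ∈ A → |∫ y, g y ∂(κ ^ k) x - ∫ y, g y ∂π| ≤ N * r ^ k

variable [hpow : ∀ k : ℕ, IsMarkovKernel (κ ^ k)] [IsProbabilityMeasure π] {N r : ℝ}

theorem ErgodicOn.lintegral_le (h : ErgodicOn κ π A N r) (hN : 0 ≤ N) (hr : 0 ≤ r)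
    {f : V → ℝ≥0∞} (hf : Measurable f) (hf1 : ∀ x, f x ≤ 1) (k : ℕ) :
    ∀ᵐ x ∂π, x ∈ A →
      ∫⁻ y, f y ∂(κ ^ k) x ≤ ∫⁻ y, f y ∂π + ENNReal.ofReal (N * r ^ k) := by
  have hne : ∀ x, f x ≠ ∞ := fun x => ((hf1 x).trans_lt ENNReal.one_lt_top).ne
  have hb : ∀ x, |(f x).toReal| ≤ 1 := fun x => by
    rw [abs_of_nonneg ENNReal.toReal_nonneg]
    exact ENNReal.toReal_le_of_le_ofReal zero_le_one (by simpa using hf1 x)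
  have key : ∀ (ρ : Measure V) [IsProbabilityMeasure ρ],
      ∫⁻ y, f y ∂ρ = ENNReal.ofReal (∫ y, (f y).toReal ∂ρ) := by
    intro ρ _
    rw [ofReal_integral_eq_lintegral_ofReal
      (Integrable.of_bound hf.ennreal_toReal.aestronglyMeasurable 1 (Eventually.of_forall hb))
      (Eventually.of_forall fun _ => ENNReal.toReal_nonneg)]
    simp only [ENNReal.ofReal_toReal (hne _)]
  filter_upwards [h _ hf.ennreal_toReal hb k] with x hx hxA
  rw [key, key π, ← ENNReal.ofReal_add (integral_nonneg fun _ => ENNReal.toReal_nonneg)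
    (by positivity)]
  refine ENNReal.ofReal_le_ofReal ?_
  linarith [(abs_le.1 (hx hxA)).2]

variable [IsMarkovKernel κ]

/-- The probability, under the stationary law, that `A` is avoided for `n` steps is summable. -/
theorem ErgodicOn.summable_taboo (h : ErgodicOn κ π A N r) (hinv : Kernel.Invariant κ π)
    (hA : MeasurableSet A) (hpos : π A ≠ 0) (hN : 0 ≤ N) (hr0 : 0 ≤ r) (hr1 : r < 1) :
    Summable fun n => (∫⁻ x, taboo κ A 1 n x ∂π).toReal := by
  have hle1 : ∀ (f : V → ℝ≥0∞), (∀ x, f x ≤ 1) → ∫⁻ x, f x ∂π ≠ ∞ := fun f hf =>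
    ((lintegral_mono hf).trans (by simp) |>.trans_lt ENNReal.one_lt_top).ne
  have hH := fun n => hle1 _ (fun x => taboo_le_one (κ := κ) (A := A) (f := 1) (fun _ => le_rfl) n x)
  have hD := fun n => hle1 _ (fun x => escape_le_one (κ := κ) (A := A) n x)
  have hrec : ∀ n, ∫⁻ x, taboo κ A 1 n x ∂π =
      ∫⁻ x, taboo κ A 1 (n + 1) x ∂π + ∫⁻ x, escape κ A n x ∂π := by
    intro n
    rw [← lintegral_lintegral_of_invariant hinv (measurable_taboo hA measurable_one n),
      ← lintegral_add_right _ (measurable_escape hA n)]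
    refine lintegral_congr fun x => ?_
    rw [add_comm, escape_add_taboo]
  have htot : ∀ n, ∑ k ∈ Finset.range n, ∫⁻ x, escape κ A (n - 1 - k) x ∂π
      + ∫⁻ x, taboo κ A 1 n x ∂π = 1 := by
    intro n
    have := lintegral_congr (μ := π) fun x => sum_escape_add_taboo (κ := κ) hA n x
    rw [lintegral_add_right _ (measurable_taboo hA measurable_one n),
      lintegral_finsetSum _ fun k _ => (measurable_escape hA _).lintegral_kernel] at this
    simpa only [lintegral_pow_of_invariant hinv (measurable_escape hA _), lintegral_const,
      measure_univ, mul_one] using this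
  -- Starting inside `A`, the avoidance term of the decomposition vanishes, because time `0` is
  -- already a visit.
  have hloc : ∀ n, ∑ k ∈ Finset.range (n + 1),
      ∫⁻ x in A, ∫⁻ y, escape κ A (n - k) y ∂(κ ^ k) x ∂π = π A := by
    intro n
    have := lintegral_congr (μ := π.restrict A) fun x => sum_escape_add_taboo (κ := κ) hA (n + 1) x
    rw [lintegral_add_right _ (measurable_taboo hA measurable_one _),
      lintegral_finsetSum _ fun k _ => (measurable_escape hA _).lintegral_kernel] at this
    have h0 : ∫⁻ x in A, taboo κ A 1 (n + 1) x ∂π = 0 := by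
      rw [setLIntegral_congr_fun hA (g := 0)]
      · simp
      · intro x hx
        simp [taboo, hx]
    rw [h0] at this
    simpa using this
  -- Invariance gives the first bound in the minimum, by dropping the restriction to `A`; uniform
  -- ergodicity on `A` gives the second.
  have hterm : ∀ m k, ∫⁻ x in A, ∫⁻ y, escape κ A m y ∂(κ ^ k) x ∂π ≤
      π A * ∫⁻ x, escape κ A m x ∂π +
        min (∫⁻ x, escape κ A m x ∂π) (ENNReal.ofReal (N * r ^ k)) := by
    intro m k
    rw [← min_add_add_left]
    refine le_min ?_ ?_
    · refine le_trans (setLIntegral_le_lintegral _ _) ?_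
      rw [lintegral_pow_of_invariant hinv (measurable_escape hA _)]
      exact le_add_self
    · have h1 : ∫⁻ x in A, ∫⁻ y, escape κ A m y ∂(κ ^ k) x ∂π ≤
          ∫⁻ _ in A, (∫⁻ y, escape κ A m y ∂π + ENNReal.ofReal (N * r ^ k)) ∂π := by
        refine lintegral_mono_ae ((ae_restrict_iff' hA).2 ?_)
        exact h.lintegral_le hN hr0 (measurable_escape hA m) (escape_le_one m) k
      refine h1.trans ?_
      rw [setLIntegral_const, add_mul, mul_comm]
      refine add_le_add le_rfl ?_
      exact (mul_le_mul_right prob_le_one _).trans (mul_one _).le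
  have hA1 : π A ≠ ∞ := measure_ne_top π A
  refine summable_of_renewal_bound (Δ := fun n => (∫⁻ x, escape κ A n x ∂π).toReal)
    (p := (π A).toReal) (N := N) (r := r) (ENNReal.toReal_pos hpos hA1) hN hr0 hr1
    (fun _ => ENNReal.toReal_nonneg) (fun _ => ENNReal.toReal_nonneg) (fun n => ?_) (fun n => ?_)
  · rw [hrec n, ENNReal.toReal_add (hH _) (hD _)]
  · have hfin : ∑ k ∈ Finset.range (n + 1), π A * ∫⁻ x, escape κ A (n - k) x ∂π ≠ ∞ :=
      ENNReal.sum_ne_top.2 fun k _ => ENNReal.mul_ne_top hA1 (hD _)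
    -- `π A` times the global decomposition and the local decomposition both equal `π A`. Their main
    -- terms cancel, which leaves the avoidance probability against the errors.
    have h2 : π A * ∫⁻ x, taboo κ A 1 (n + 1) x ∂π ≤ ∑ k ∈ Finset.range (n + 1),
        min (∫⁻ x, escape κ A (n - k) x ∂π) (ENNReal.ofReal (N * r ^ k)) := by
      refine (ENNReal.add_le_add_iff_left hfin).1 ?_
      rw [← Finset.mul_sum, ← mul_add]
      have := htot (n + 1)
      simp only [Nat.add_sub_cancel] at this
      rw [this, mul_one, Finset.mul_sum, ← Finset.sum_add_distrib]
      calc π A = _ := (hloc n).symm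
        _ ≤ _ := Finset.sum_le_sum fun k _ => hterm (n - k) k
    have hmin : ∀ k ∈ Finset.range (n + 1),
        min (∫⁻ x, escape κ A (n - k) x ∂π) (ENNReal.ofReal (N * r ^ k)) ≠ ∞ := fun k _ =>
      ((min_le_left _ _).trans_lt (hD _).lt_top).ne
    have h3 := ENNReal.toReal_mono (ENNReal.sum_ne_top.2 hmin) h2
    rw [ENNReal.toReal_mul, ENNReal.toReal_sum hmin] at h3
    refine h3.trans (Finset.sum_le_sum fun k _ => le_min ?_ ?_)
    · exact ENNReal.toReal_mono (hD _) (min_le_left _ _)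
    · refine (ENNReal.toReal_mono ENNReal.ofReal_ne_top (min_le_right _ _)).trans ?_
      rw [ENNReal.toReal_ofReal (by positivity)]

omit [IsMarkovKernel κ] in
theorem integral_pow_succ (k : ℕ) (x : V) {g : V → ℝ} (hg : Measurable g) {B : ℝ}
    (hB : ∀ x, |g x| ≤ B) :
    ∫ y, g y ∂(κ ^ (k + 1)) x = ∫ y, ∫ z, g z ∂(κ ^ k) y ∂κ x := by
  have : IsMarkovKernel ((κ ^ k) ∘ₖ (κ ^ 1)) := by
    rw [← Kernel.pow_add]
    infer_instance
  rw [Kernel.pow_add, Kernel.integral_comp, pow_one]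
  exact Integrable.of_bound hg.aestronglyMeasurable B (Eventually.of_forall hB)

omit [IsMarkovKernel κ] in
theorem integral_pow_succ' (k : ℕ) (x : V) {g : V → ℝ} (hg : Measurable g) {B : ℝ}
    (hB : ∀ x, |g x| ≤ B) :
    ∫ y, g y ∂(κ ^ (k + 1)) x = ∫ y, ∫ z, g z ∂κ y ∂(κ ^ k) x := by
  have : IsMarkovKernel ((κ ^ 1) ∘ₖ (κ ^ k)) := by
    rw [← Kernel.pow_add]
    infer_instance
  rw [add_comm, Kernel.pow_add, Kernel.integral_comp, pow_one]
  exact Integrable.of_bound hg.aestronglyMeasurable B (Eventually.of_forall hB)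

theorem measurable_integral_kernel {W : Type*} [MeasurableSpace W] (η : Kernel W V)
    [IsSFiniteKernel η] {g : V → ℝ} (hg : Measurable g) :
    Measurable fun x => ∫ y, g y ∂η x :=
  (hg.stronglyMeasurable.integral_kernel (κ := η)).measurable

theorem abs_integral_le_of_abs_le {W : Type*} [MeasurableSpace W] {μ : Measure W}
    [IsProbabilityMeasure μ] {g : W → ℝ} {B : ℝ} (hB : ∀ x, |g x| ≤ B) :
    |∫ x, g x ∂μ| ≤ B := by
  have := norm_integral_le_of_norm_le_const (μ := μ) (f := g) (C := B) (Eventually.of_forall hB)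
  simpa using this

/-- Jensen's inequality after the first step. This one-step domination is the hypothesis `hsub` of
the first-visit decomposition. -/
theorem enorm_integral_pow_sub_le (k : ℕ) (x : V) {g : V → ℝ} (hg : Measurable g) {B : ℝ}
    (hB : ∀ x, |g x| ≤ B) (c : ℝ) :
    ‖∫ y, g y ∂(κ ^ (k + 1)) x - c‖ₑ ≤ ∫⁻ y, ‖∫ z, g z ∂(κ ^ k) y - c‖ₑ ∂κ x := by
  have hint : Integrable (fun y => ∫ z, g z ∂(κ ^ k) y) (κ x) :=
    Integrable.of_bound (measurable_integral_kernel _ hg).aestronglyMeasurable B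
      (Eventually.of_forall fun y => abs_integral_le_of_abs_le hB)
  have : ∫ y, g y ∂(κ ^ (k + 1)) x - c = ∫ y, (∫ z, g z ∂(κ ^ k) y - c) ∂κ x := by
    rw [integral_sub hint (integrable_const c), integral_pow_succ k x hg hB]
    simp
  rw [this]
  exact enorm_integral_le_lintegral_enorm _

omit hpow [IsProbabilityMeasure π] [IsMarkovKernel κ] in
/-- Decomposition with respect to the first visit of `A`. -/
theorem lintegral_le_sum_add_taboo (hinv : Kernel.Invariant κ π) (hA : MeasurableSet A)
    {φ : ℕ → V → ℝ≥0∞} (hφ : ∀ k, Measurable (φ k))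
    (hsub : ∀ k x, φ (k + 1) x ≤ ∫⁻ y, φ k y ∂κ x) (m l : ℕ) :
    ∫⁻ x, φ (l + m) x ∂π ≤
      ∑ j ∈ Finset.range m, ∫⁻ x in A, φ (l + 1 + j) x ∂π + ∫⁻ x, taboo κ A (φ l) m x ∂π := by
  induction m generalizing l with
  | zero => simp [taboo]
  | succ m ih =>
    have h1 := ih (l + 1)
    have e1 : l + 1 + m = l + (m + 1) := by omega
    rw [e1] at h1
    refine h1.trans ?_
    rw [Finset.sum_range_succ', add_assoc (Finset.sum _ _)]
    refine add_le_add (Finset.sum_le_sum fun j _ => ?_) ?_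
    · have : l + 1 + 1 + j = l + 1 + (j + 1) := by omega
      rw [this]
    · have hsplit : ∀ x, φ (l + 1) x ≤
          A.indicator (φ (l + 1)) x + taboo κ A (φ l) 1 x := by
        intro x
        by_cases hx : x ∈ A
        · simp [hx]
        · simp only [taboo, indicator_of_notMem hx, indicator_of_mem (mem_compl hx), zero_add]
          exact hsub l x
      rw [add_zero, taboo_succ', ← lintegral_indicator hA]
      calc ∫⁻ x, taboo κ A (φ (l + 1)) m x ∂π
          ≤ ∫⁻ x, (taboo κ A (A.indicator (φ (l + 1))) m x +
              taboo κ A (taboo κ A (φ l) 1) m x) ∂π := by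
            refine lintegral_mono fun x => ?_
            rw [← taboo_add hA ((hφ (l + 1)).indicator hA)]
            exact taboo_mono hsplit m x
        _ = ∫⁻ x, taboo κ A (A.indicator (φ (l + 1))) m x ∂π +
              ∫⁻ x, taboo κ A (taboo κ A (φ l) 1) m x ∂π :=
            lintegral_add_left (measurable_taboo hA ((hφ (l + 1)).indicator hA) m) _
        _ ≤ _ := add_le_add (lintegral_taboo_le hinv hA ((hφ (l + 1)).indicator hA) m) le_rfl

theorem summable_comp_div_two {f : ℕ → ℝ} (hf : Summable f) : Summable fun k => f (k / 2) := by
  have h1 : HasSum (fun k => f (2 * k / 2)) (∑' k, f k) := by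
    simpa using hf.hasSum
  have h2 : HasSum (fun k => f ((2 * k + 1) / 2)) (∑' k, f k) := by
    have : ∀ k, (2 * k + 1) / 2 = k := fun k => by omega
    simpa only [this] using hf.hasSum
  exact (HasSum.even_add_odd (f := fun k => f (k / 2)) h1 h2).summable

/-- Uniform geometric ergodicity from a set of positive stationary mass gives a summable rate of
mixing under the stationary law. -/
theorem ErgodicOn.exists_summable_rate (h : ErgodicOn κ π A N r) (hinv : Kernel.Invariant κ π)
    (hA : MeasurableSet A) (hpos : π A ≠ 0) (hN : 0 ≤ N) (hr0 : 0 ≤ r) (hr1 : r < 1) :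
    ∃ a : ℕ → ℝ, Summable a ∧ (∀ k, 0 ≤ a k) ∧ ∀ g : V → ℝ, Measurable g → (∀ x, |g x| ≤ 1) →
      ∀ k, ∫ x, |∫ y, g y ∂(κ ^ k) x - ∫ y, g y ∂π| ∂π ≤ a k := by
  set H : ℕ → ℝ := fun n => (∫⁻ x, taboo κ A 1 n x ∂π).toReal with hHdef
  have hHsum : Summable H := h.summable_taboo hinv hA hpos hN hr0 hr1
  have hHfin : ∀ n, ∫⁻ x, taboo κ A 1 n x ∂π ≠ ∞ := fun n =>
    ((lintegral_mono fun x => taboo_le_one (fun _ => le_rfl) n x).trans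
      (by simp) |>.trans_lt ENNReal.one_lt_top).ne
  have hH0 : ∀ n, 0 ≤ H n := fun n => ENNReal.toReal_nonneg
  -- With `m = k / 2`, the first term counts `m` possible times of the first visit, each with error
  -- at most `N * r ^ m`. The factor `2` bounds the deviation when `A` is avoided.
  set f : ℕ → ℝ := fun n => n * (N * r ^ n) + 2 * H n with hf
  have hfsum : Summable f := by
    have h1 : Summable fun k : ℕ => (k : ℝ) ^ 1 * r ^ k :=
      summable_pow_mul_geometric_of_norm_lt_one 1 (by rwa [Real.norm_of_nonneg hr0])
    refine ((h1.mul_left N).add (hHsum.mul_left 2)).congr fun k => ?_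
    simp only [hf]
    ring
  refine ⟨fun k => f (k / 2), summable_comp_div_two hfsum, fun k => ?_, fun g hg hg1 k => ?_⟩
  · have := hH0 (k / 2)
    simp only [hf]
    positivity
  set c := ∫ y, g y ∂π with hc
  set φ : ℕ → V → ℝ≥0∞ := fun k x => ‖∫ y, g y ∂(κ ^ k) x - c‖ₑ with hφdef
  have hφreal : ∀ k, Measurable fun x => ∫ y, g y ∂(κ ^ k) x - c := fun k =>
    (measurable_integral_kernel _ hg).sub_const c
  have hφ : ∀ k, Measurable (φ k) := fun k => (hφreal k).enorm
  have hφ2 : ∀ k x, φ k x ≤ 2 * (1 : V → ℝ≥0∞) x := by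
    intro k x
    have h1 : |∫ y, g y ∂(κ ^ k) x| ≤ 1 := abs_integral_le_of_abs_le hg1
    have h2 : |c| ≤ 1 := abs_integral_le_of_abs_le hg1
    have h3 : |∫ y, g y ∂(κ ^ k) x - c| ≤ 2 := by
      rw [abs_le] at h1 h2 ⊢
      constructor <;> linarith [h1.1, h1.2, h2.1, h2.2]
    simp only [hφdef, Pi.one_apply, mul_one, Real.enorm_eq_ofReal_abs]
    exact (ENNReal.ofReal_le_ofReal h3).trans (by simp)
  -- As `l = k - m ≥ m`, every exponent `l + 1 + j` that occurs at a visit exceeds `m`.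
  set m := k / 2 with hm
  obtain ⟨l, hl⟩ : ∃ l, k = l + m := ⟨k - m, by omega⟩
  have hml : m ≤ l := by omega
  have hmain := lintegral_le_sum_add_taboo hinv hA hφ
    (fun k x => enorm_integral_pow_sub_le k x hg hg1 c) m l
  have hA_term : ∀ j ∈ Finset.range m, ∫⁻ x in A, φ (l + 1 + j) x ∂π ≤
      ENNReal.ofReal (N * r ^ m) := by
    intro j _
    have h1 : ∫⁻ x in A, φ (l + 1 + j) x ∂π ≤ ∫⁻ _ in A, ENNReal.ofReal (N * r ^ m) ∂π := by
      refine lintegral_mono_ae ((ae_restrict_iff' hA).2 ?_)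
      filter_upwards [h g hg hg1 (l + 1 + j)] with x hx hxA
      simp only [hφdef, Real.enorm_eq_ofReal_abs]
      refine ENNReal.ofReal_le_ofReal ((hx hxA).trans ?_)
      exact mul_le_mul_of_nonneg_left (pow_le_pow_of_le_one hr0 hr1.le (by omega)) hN
    refine h1.trans ?_
    rw [setLIntegral_const]
    exact (mul_le_mul_right prob_le_one _).trans (mul_one _).le
  have hT : ∫⁻ x, taboo κ A (φ l) m x ∂π ≤ ENNReal.ofReal (2 * H m) := by
    calc ∫⁻ x, taboo κ A (φ l) m x ∂π ≤ ∫⁻ x, 2 * taboo κ A 1 m x ∂π := by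
          refine lintegral_mono fun x => ?_
          rw [← taboo_const_mul hA measurable_one]
          exact taboo_mono (hφ2 l) m x
      _ = 2 * ∫⁻ x, taboo κ A 1 m x ∂π :=
          lintegral_const_mul _ (measurable_taboo hA measurable_one m)
      _ = ENNReal.ofReal (2 * H m) := by
          rw [ENNReal.ofReal_mul zero_le_two, hHdef]
          simp only [ENNReal.ofReal_toReal (hHfin m)]
          simp
  have hfinal : ∫⁻ x, φ k x ∂π ≤ ENNReal.ofReal (f m) := by
    rw [hl]
    refine hmain.trans ((add_le_add (Finset.sum_le_sum hA_term) hT).trans (le_of_eq ?_))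
    rw [Finset.sum_const, Finset.card_range, nsmul_eq_mul, hf,
      ENNReal.ofReal_add (by positivity) (mul_nonneg zero_le_two (hH0 m)),
      ENNReal.ofReal_mul (Nat.cast_nonneg m), ENNReal.ofReal_natCast]
  have hfm : 0 ≤ f m := by
    have := hH0 m
    simp only [hf]
    positivity
  rw [integral_eq_lintegral_of_nonneg_ae (Eventually.of_forall fun _ => abs_nonneg _)
    (continuous_abs.measurable.comp (hφreal k)).aestronglyMeasurable]
  refine ENNReal.toReal_le_of_le_ofReal hfm (le_trans (le_of_eq ?_) hfinal)
  simp only [hφdef, Real.enorm_eq_ofReal_abs]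

end MarkovChain

/-! ### From pointwise to uniform ergodicity, and invariance of the limit -/

namespace MarkovChain

variable {V : Type*} [MeasurableSpace V] {κ : Kernel V V} {π : Measure V}
  [hpow : ∀ k : ℕ, IsMarkovKernel (κ ^ k)] [IsProbabilityMeasure π] {b : ℝ}

/-- A chain that converges geometrically from almost every point converges at a uniform
geometric rate from the points of a set of positive stationary mass. -/
theorem exists_ergodicOn (hb : 1 < b)
    (hgeom : ∀ᵐ x ∂π, (fun n : ℕ => tvNorm ((κ ^ n) x) π) =O[atTop] fun n : ℕ => (b ^ n)⁻¹) :
    ∃ (A : Set V) (N : ℝ), MeasurableSet A ∧ π A ≠ 0 ∧ 0 ≤ N ∧ ErgodicOn κ π A N b⁻¹ := by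
  have hb0 : 0 < b := one_pos.trans hb
  -- Almost every point lies in some `s N`, so one of these countably many sets has positive outer
  -- measure. They are not known to be measurable, hence the measurable hull below.
  set s : ℕ → Set V := fun N => {x | ∀ k : ℕ, tvNorm ((κ ^ k) x) π ≤ N * b⁻¹ ^ k} with hs
  have hcover : ∀ᵐ x ∂π, x ∈ ⋃ N, s N := by
    filter_upwards [hgeom] with x hx
    -- The comparison sequence never vanishes, so the bound holds for every `k` and not only
    -- eventually.
    obtain ⟨C, -, hC⟩ := bound_of_isBigO_nat_atTop hx
    obtain ⟨N, hN⟩ := exists_nat_ge C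
    refine mem_iUnion.2 ⟨N, fun k => ?_⟩
    have h1 := hC (x := k) (by positivity)
    rw [Real.norm_of_nonneg (tvNorm_nonneg _ _), Real.norm_of_nonneg (by positivity),
      ← inv_pow] at h1
    exact h1.trans (by gcongr)
  obtain ⟨N, hN⟩ : ∃ N, π (s N) ≠ 0 := by
    by_contra hcon
    push Not at hcon
    have h0 : π (⋃ N, s N) = 0 := measure_iUnion_null hcon
    have h1 : ∀ᵐ _ ∂π, False := by
      filter_upwards [hcover, measure_eq_zero_iff_ae_notMem.1 h0] with x h h' using h' h
    exact (IsProbabilityMeasure.ne_zero π) (by simpa using h1)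
  refine ⟨toMeasurable π (s N), N, measurableSet_toMeasurable _ _, ?_, Nat.cast_nonneg N,
    fun g hg hg1 k => ?_⟩
  · rwa [measure_toMeasurable]
  -- For fixed `g` and `k` the good set is measurable and contains `s N`, so it contains the
  -- measurable hull up to a null set. This is why `ErgodicOn` has its almost-everywhere quantifier
  -- inside the one over test functions.
  · set G : Set V := {x | |∫ y, g y ∂(κ ^ k) x - ∫ y, g y ∂π| ≤ N * b⁻¹ ^ k} with hG
    have hGm : MeasurableSet G := by
      refine measurableSet_le ?_ measurable_const
      exact continuous_abs.measurable.comp ((measurable_integral_kernel _ hg).sub_const _)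
    have hsG : s N ∩ Gᶜ = ∅ := by
      refine disjoint_iff_inter_eq_empty.1 (disjoint_compl_right_iff_subset.2 fun x hx => ?_)
      refine (abs_integral_sub_le_tvNorm _ _ hg hg1).trans ?_
      rw [one_mul]
      exact hx k
    have h0 : π (toMeasurable π (s N) ∩ Gᶜ) = 0 := by
      rw [Measure.measure_toMeasurable_inter hGm.compl (measure_ne_top _ _), hsG, measure_empty]
    filter_upwards [measure_eq_zero_iff_ae_notMem.1 h0] with x hx hxA
    by_contra hxG
    exact hx ⟨hxA, hxG⟩

theorem tendsto_integral_of_isBigO (hb : 1 < b) {μ : ℕ → Measure V} [∀ n, IsFiniteMeasure (μ n)]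
    (h : (fun n : ℕ => tvNorm (μ n) π) =O[atTop] fun n : ℕ => (b ^ n)⁻¹)
    {g : V → ℝ} (hg : Measurable g) (hg1 : ∀ x, |g x| ≤ 1) :
    Tendsto (fun n => ∫ y, g y ∂(μ n)) atTop (𝓝 (∫ y, g y ∂π)) := by
  have h0 : Tendsto (fun n : ℕ => (b ^ n)⁻¹) atTop (𝓝 0) :=
    tendsto_inv_atTop_zero.comp (tendsto_pow_atTop_atTop_of_one_lt hb)
  rw [tendsto_iff_norm_sub_tendsto_zero]
  refine squeeze_zero (fun _ => norm_nonneg _) (fun n => ?_) (h.trans_tendsto h0)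
  have := abs_integral_sub_le_tvNorm (μ n) π hg hg1
  rwa [one_mul] at this

/-- The limit law of a geometrically ergodic chain is invariant. -/
theorem invariant_of_isBigO [IsMarkovKernel κ] (hb : 1 < b) {x : V}
    (h : (fun n : ℕ => tvNorm ((κ ^ n) x) π) =O[atTop] fun n : ℕ => (b ^ n)⁻¹) :
    Kernel.Invariant κ π := by
  refine Measure.ext fun B hB => ?_
  have hreal : ∀ (ρ : Measure V), ∫ y, B.indicator (1 : V → ℝ) y ∂ρ = ρ.real B := fun ρ => by
    rw [integral_indicator_one hB]
  set f : V → ℝ := B.indicator 1 with hf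
  have hfm : Measurable f := measurable_one.indicator hB
  have hf1 : ∀ y, |f y| ≤ 1 := fun y => by
    simp only [hf, indicator]
    split_ifs <;> simp
  have hgm : Measurable fun y => ∫ z, f z ∂κ y := measurable_integral_kernel κ hfm
  have hg1 : ∀ y, |∫ z, f z ∂κ y| ≤ 1 := fun y => abs_integral_le_of_abs_le hf1
  -- The integrals of `f` under `κ ^ (n + 1)` are those of `κ f` under `κ ^ n`, so they converge
  -- both to `∫ f dπ` and to `∫ κ f dπ`.
  have t1 := (tendsto_integral_of_isBigO hb h hfm hf1).comp (tendsto_add_atTop_nat 1)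
  have t2 := tendsto_integral_of_isBigO hb h hgm hg1
  have heq := tendsto_nhds_unique (t1.congr fun n => integral_pow_succ' n x hfm hf1) t2
  have hbind : ∫ y, ∫ z, f z ∂κ y ∂π = (π.bind κ).real B := by
    simp only [hreal, Measure.real]
    rw [integral_toReal (κ.measurable_coe hB).aemeasurable
      (Eventually.of_forall fun y => measure_lt_top _ _),
      Measure.bind_apply hB κ.aemeasurable]
  rw [hbind, hreal] at heq
  exact ((measureReal_eq_measureReal_iff).1 heq).symm

end MarkovChain

theorem ProbabilityTheory.HasCondDistrib.integral_mul_comp {Ω V W : Type*} [MeasurableSpace Ω]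
    [MeasurableSpace V] [MeasurableSpace W] {P : Measure Ω} [IsProbabilityMeasure P]
    {X : Ω → V} {Y : Ω → W} {κ : Kernel V W} [IsMarkovKernel κ] (h : HasCondDistrib Y X κ P)
    {U : V → ℝ} (hU : Measurable U) {F : W → ℝ} (hF : Measurable F)
    (hU1 : ∀ x, |U x| ≤ 1) (hF1 : ∀ y, |F y| ≤ 1) :
    ∫ ω, U (X ω) * F (Y ω) ∂P = ∫ ω, U (X ω) * ∫ y, F y ∂κ (X ω) ∂P := by
  have hm : Measurable fun p : V × W => U p.1 * F p.2 := by fun_prop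
  have : IsProbabilityMeasure (P.map X) :=
    Measure.isProbabilityMeasure_map h.aemeasurable_fst
  have hint : Integrable (fun p : V × W => U p.1 * F p.2) (P.map X ⊗ₘ κ) := by
    refine Integrable.of_bound hm.aestronglyMeasurable 1 (Eventually.of_forall fun p => ?_)
    rw [Real.norm_eq_abs, abs_mul]
    exact mul_le_one₀ (hU1 _) (abs_nonneg _) (hF1 _)
  have hmF : Measurable fun x => ∫ y, F y ∂κ x := MarkovChain.measurable_integral_kernel κ hF
  calc ∫ ω, U (X ω) * F (Y ω) ∂P
      = ∫ p, U p.1 * F p.2 ∂(P.map fun ω => (X ω, Y ω)) :=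
        (integral_map h.aemeasurable hm.aestronglyMeasurable).symm
    _ = ∫ p, U p.1 * F p.2 ∂(P.map X ⊗ₘ κ) := by rw [h.map_eq]
    _ = ∫ x, ∫ y, U x * F y ∂κ x ∂(P.map X) := Measure.integral_compProd hint
    _ = ∫ x, U x * ∫ y, F y ∂κ x ∂(P.map X) := by simp only [integral_const_mul]
    _ = _ := integral_map h.aemeasurable_fst (hU.mul hmF).aestronglyMeasurable

/-! ### Covariances and variances along the embedded chain -/

namespace PDMP

variable {d : ℕ} (X : PDMP d)

instance : IsMarkovKernel X.pairKernel := by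
  unfold pairKernel
  infer_instance

/-- The conditional mean of `F (Z_n, S_{n+1})` given `Z_n`. -/
noncomputable def timeMean (F : Space d × ℝ → ℝ) (ξ : Space d) : ℝ :=
  ∫ s, F (ξ, s) ∂X.interJump ξ

variable {X} {F : Space d × ℝ → ℝ}

theorem measurable_timeMean (hF : Measurable F) : Measurable (X.timeMean F) :=
  (hF.stronglyMeasurable.integral_kernel_prod_right' (κ := X.interJump)).measurable

theorem abs_timeMean_le {B : ℝ} (hF1 : ∀ p, |F p| ≤ B) (ξ : Space d) : |X.timeMean F ξ| ≤ B :=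
  MarkovChain.abs_integral_le_of_abs_le fun _ => hF1 _

theorem timeMean_comp_fst (g : Space d → ℝ) : X.timeMean (fun p => g p.1) = g := by
  funext ξ
  simp [timeMean]

theorem integral_pairKernel (hF : Measurable F) (hF1 : ∀ p, |F p| ≤ 1) (y : Space d × ℝ) :
    ∫ p, F p ∂X.pairKernel y = ∫ ξ, X.timeMean F ξ ∂X.Q (X.Φ y.1 y.2) := by
  have hint : Integrable F (X.pairKernel y) :=
    Integrable.of_bound hF.aestronglyMeasurable 1 (Eventually.of_forall hF1)
  unfold pairKernel at hint ⊢
  rw [integral_compProd hint]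
  rfl

theorem integral_postJump {g : Space d → ℝ} (hg : Measurable g) (hg1 : ∀ x, |g x| ≤ 1)
    (x : Space d) :
    ∫ y, g y ∂X.postJump x = ∫ s, ∫ ξ, g ξ ∂X.Q (X.Φ x s) ∂X.interJump x := by
  have hint : Integrable g (X.postJump x) :=
    Integrable.of_bound hg.aestronglyMeasurable 1 (Eventually.of_forall hg1)
  have hm : Measurable fun p : Space d × ℝ => ∫ ξ, g ξ ∂X.Q (X.Φ p.1 p.2) :=
    (MarkovChain.measurable_integral_kernel X.Q hg).comp X.measurable_Φ
  unfold postJump at hint ⊢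
  rw [Kernel.integral_comp hint, Kernel.prod_apply, Kernel.id_apply, Measure.dirac_prod]
  exact integral_map (by fun_prop) hm.aestronglyMeasurable

/-- Averaging over the inter-jumping time intertwines the kernel of the pairs with that of the
post-jump locations. Powers of `postJump` thereby govern functions of the pairs. -/
theorem timeMean_integral_pairKernel (hF : Measurable F) (hF1 : ∀ p, |F p| ≤ 1) (x : Space d) :
    X.timeMean (fun y => ∫ p, F p ∂X.pairKernel y) x = ∫ y, X.timeMean F y ∂X.postJump x := by
  rw [integral_postJump (measurable_timeMean hF) (abs_timeMean_le hF1)]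
  simp only [integral_pairKernel hF hF1]
  rfl

variable {Ω : Type*} [MeasurableSpace Ω] {P : Measure Ω} [IsProbabilityMeasure P]
  {Z : ℕ → Ω → Space d} {S : ℕ → Ω → ℝ} {U : Space d × ℝ → ℝ}

theorem IsEmbeddedChain.integral_mul_succ (h : X.IsEmbeddedChain P Z S) (hU : Measurable U)
    (hU1 : ∀ p, |U p| ≤ 1) (hF : Measurable F) (hF1 : ∀ p, |F p| ≤ 1) {i n : ℕ} (hin : i ≤ n) :
    ∫ ω, U (Z i ω, S (i + 1) ω) * F (Z (n + 1) ω, S (n + 2) ω) ∂P =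
      ∫ ω, U (Z i ω, S (i + 1) ω) * ∫ p, F p ∂X.pairKernel (Z n ω, S (n + 1) ω) ∂P :=
  (h.transition n).integral_mul_comp
    (U := fun w : Fin (n + 1) → Space d × ℝ => U (w ⟨i, Nat.lt_succ_of_le hin⟩))
    (hU.comp (measurable_pi_apply _)) hF (fun _ => hU1 _) hF1

/-- The Markov property at time `i + 1`. -/
theorem IsEmbeddedChain.integral_mul_eq (h : X.IsEmbeddedChain P Z S) (hU : Measurable U)
    (hU1 : ∀ p, |U p| ≤ 1) (hF : Measurable F) (hF1 : ∀ p, |F p| ≤ 1) (i k : ℕ) :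
    ∫ ω, U (Z i ω, S (i + 1) ω) * F (Z (i + 1 + k) ω, S (i + 1 + k + 1) ω) ∂P =
      ∫ ω, U (Z i ω, S (i + 1) ω) *
        ∫ y, X.timeMean F y ∂(X.postJump ^ k) (Z (i + 1) ω) ∂P := by
  induction k generalizing F with
  | zero =>
    have h0 : ∀ x, ∫ y, X.timeMean F y ∂(X.postJump ^ 0) x = X.timeMean F x := by
      intro x
      have : (X.postJump ^ 0) x = Measure.dirac x := by
        rw [pow_zero]
        exact Kernel.id_apply x
      rw [this, integral_dirac' _ _ (measurable_timeMean hF).stronglyMeasurable]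
    simp only [h0]
    have hm : Measurable fun p : Space d × ℝ => X.timeMean F p.1 :=
      (measurable_timeMean hF).comp measurable_fst
    have hb : ∀ p : Space d × ℝ, |X.timeMean F p.1| ≤ 1 := fun p => abs_timeMean_le hF1 _
    -- `F` and its conditional mean given the location have the same integral under `pairKernel`, so
    -- both integrals agree with a common third one.
    have e1 := h.integral_mul_succ hU hU1 hF hF1 (le_refl i)
    have e2 := h.integral_mul_succ hU hU1 hm hb (le_refl i)
    simp only [integral_pairKernel hF hF1] at e1
    simp only [integral_pairKernel hm hb, timeMean_comp_fst] at e2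
    exact e1.trans e2.symm
  | succ k ih =>
    have hm : Measurable fun y => ∫ p, F p ∂X.pairKernel y :=
      MarkovChain.measurable_integral_kernel _ hF
    have hb : ∀ y, |∫ p, F p ∂X.pairKernel y| ≤ 1 := fun y =>
      MarkovChain.abs_integral_le_of_abs_le hF1
    -- The last transition is integrated out first, and the induction hypothesis is applied to the
    -- function `∫ F d(pairKernel)`.
    have e1 := h.integral_mul_succ hU hU1 hF hF1 (show i ≤ i + 1 + k by omega)
    refine e1.trans ((ih hm hb).trans ?_)
    refine integral_congr_ae (Eventually.of_forall fun ω => ?_)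
    simp only [timeMean_integral_pairKernel hF hF1]
    rw [MarkovChain.integral_pow_succ' k _ (measurable_timeMean hF) (abs_timeMean_le hF1)]

variable {π : Measure (Space d)} [IsProbabilityMeasure π]

/-- Conditioning at time `i + 1` replaces the later factor by `ψ (Z (i + 1))`, and subtracting the
constant `c` does not change the covariance. Both resulting terms are at most `E|ψ (Z (i + 1)) -
c|`. As the integrand is at most `2`, passing to the law `π` costs `2 * tvNorm`. -/
theorem IsEmbeddedChain.abs_covariance_le (h : X.IsEmbeddedChain P Z S) {a : ℕ → ℝ}
    (ha : ∀ g : Space d → ℝ, Measurable g → (∀ x, |g x| ≤ 1) →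
      ∀ k, ∫ x, |∫ y, g y ∂(X.postJump ^ k) x - ∫ y, g y ∂π| ∂π ≤ a k)
    (hU : Measurable U) (hU1 : ∀ p, |U p| ≤ 1) (hF : Measurable F) (hF1 : ∀ p, |F p| ≤ 1)
    (i k : ℕ) :
    |cov[fun ω => U (Z i ω, S (i + 1) ω),
      fun ω => F (Z (i + 1 + k) ω, S (i + 1 + k + 1) ω); P]| ≤
      2 * (a k + 2 * tvNorm (P.map (Z (i + 1))) π) := by
  have hY : ∀ n, Measurable fun ω => (Z n ω, S (n + 1) ω) := fun n =>
    (h.measurable_Z n).prodMk (h.measurable_S n)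
  have hUm : Measurable fun ω => U (Z i ω, S (i + 1) ω) := hU.comp (hY i)
  have hFm : Measurable fun ω => F (Z (i + 1 + k) ω, S (i + 1 + k + 1) ω) := hF.comp (hY _)
  set g := X.timeMean F with hg
  have hgm : Measurable g := measurable_timeMean hF
  have hg1 : ∀ x, |g x| ≤ 1 := abs_timeMean_le hF1
  set c := ∫ y, g y ∂π with hc
  set ψ : Space d → ℝ := fun x => ∫ y, g y ∂(X.postJump ^ k) x with hψ
  have hψm : Measurable ψ := MarkovChain.measurable_integral_kernel _ hgm
  have hψ1 : ∀ x, |ψ x| ≤ 1 := fun x => MarkovChain.abs_integral_le_of_abs_le hg1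
  have hc1 : |c| ≤ 1 := MarkovChain.abs_integral_le_of_abs_le hg1
  set D : Ω → ℝ := fun ω => ψ (Z (i + 1) ω) - c with hD
  have hDm : Measurable D := (hψm.comp (h.measurable_Z _)).sub_const c
  have hψc : ∀ x, |ψ x - c| ≤ 2 := fun x => by
    have h1 := abs_le.1 (hψ1 x)
    have h2 := abs_le.1 hc1
    rw [abs_le]
    constructor <;> linarith [h1.1, h1.2, h2.1, h2.2]
  have hbdd : ∀ {f : Ω → ℝ} {B : ℝ}, Measurable f → (∀ ω, |f ω| ≤ B) → Integrable f P :=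
    fun hf hb => Integrable.of_bound hf.aestronglyMeasurable _ (Eventually.of_forall hb)
  have e1 := h.integral_mul_eq hU hU1 hF hF1 i k
  have e2 := h.integral_mul_eq (U := fun _ => 1) measurable_const (by simp) hF hF1 i k
  simp only [one_mul] at e2
  have hUint : Integrable (fun ω => U (Z i ω, S (i + 1) ω)) P := hbdd hUm fun _ => hU1 _
  have hψint : Integrable (fun ω => ψ (Z (i + 1) ω)) P :=
    hbdd (hψm.comp (h.measurable_Z _)) fun _ => hψ1 _
  have hUψint : Integrable (fun ω => U (Z i ω, S (i + 1) ω) * ψ (Z (i + 1) ω)) P := by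
    refine hbdd (B := 1) (hUm.mul (hψm.comp (h.measurable_Z _))) fun ω => ?_
    rw [abs_mul]
    exact mul_le_one₀ (hU1 _) (abs_nonneg _) (hψ1 _)
  have hDint : Integrable D P := hbdd hDm fun _ => hψc _
  have hcov : cov[fun ω => U (Z i ω, S (i + 1) ω),
      fun ω => F (Z (i + 1 + k) ω, S (i + 1 + k + 1) ω); P] =
      ∫ ω, U (Z i ω, S (i + 1) ω) * D ω ∂P - (∫ ω, U (Z i ω, S (i + 1) ω) ∂P) * ∫ ω, D ω ∂P := by
    rw [covariance_eq_sub
      (MemLp.of_bound hUm.aestronglyMeasurable 1 (Eventually.of_forall fun _ => hU1 _))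
      (MemLp.of_bound hFm.aestronglyMeasurable 1 (Eventually.of_forall fun _ => hF1 _))]
    simp only [Pi.mul_apply]
    rw [e1, e2]
    have h1 : ∫ ω, U (Z i ω, S (i + 1) ω) * D ω ∂P =
        ∫ ω, U (Z i ω, S (i + 1) ω) * ψ (Z (i + 1) ω) ∂P
          - (∫ ω, U (Z i ω, S (i + 1) ω) ∂P) * c := by
      simp only [hD, mul_sub]
      rw [integral_sub hUψint (hUint.mul_const c), integral_mul_const]
    have h2 : ∫ ω, D ω ∂P = ∫ ω, ψ (Z (i + 1) ω) ∂P - c := by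
      simp only [hD]
      rw [integral_sub hψint (integrable_const c)]
      simp
    rw [h1, h2]
    ring
  have hUD : |∫ ω, U (Z i ω, S (i + 1) ω) * D ω ∂P| ≤ ∫ ω, |D ω| ∂P := by
    refine abs_integral_le_integral_abs.trans ?_
    refine integral_mono_of_nonneg (Eventually.of_forall fun _ => abs_nonneg _) hDint.abs
      (Eventually.of_forall fun ω => ?_)
    simp only [abs_mul]
    exact mul_le_of_le_one_left (abs_nonneg _) (hU1 _)
  have hD' : |∫ ω, D ω ∂P| ≤ ∫ ω, |D ω| ∂P := abs_integral_le_integral_abs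
  have hU' : |∫ ω, U (Z i ω, S (i + 1) ω) ∂P| ≤ 1 :=
    MarkovChain.abs_integral_le_of_abs_le fun _ => hU1 _
  have habs : Measurable fun x => |ψ x - c| := continuous_abs.measurable.comp (hψm.sub_const c)
  have hDmap : ∫ ω, |D ω| ∂P = ∫ x, |ψ x - c| ∂(P.map (Z (i + 1))) :=
    (integral_map (h.measurable_Z _).aemeasurable habs.aestronglyMeasurable).symm
  have htv := abs_integral_sub_le_tvNorm (P.map (Z (i + 1))) π habs (B := 2)
    fun x => by rw [abs_abs]; exact hψc x
  have hak : ∫ x, |ψ x - c| ∂π ≤ a k := ha g hgm hg1 k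
  rw [hcov]
  calc _ ≤ |∫ ω, U (Z i ω, S (i + 1) ω) * D ω ∂P|
        + |∫ ω, U (Z i ω, S (i + 1) ω) ∂P| * |∫ ω, D ω ∂P| := by
        rw [← abs_mul]
        exact abs_sub _ _
    _ ≤ ∫ ω, |D ω| ∂P + 1 * ∫ ω, |D ω| ∂P :=
        add_le_add hUD (mul_le_mul hU' hD' (abs_nonneg _) zero_le_one)
    _ ≤ _ := by
        rw [hDmap]
        linarith [(abs_le.1 htv).2]

/-- The variance of the partial sums of functions bounded by `1` of the embedded chain grows at
most linearly. -/
theorem IsEmbeddedChain.exists_variance_sum_le (h : X.IsEmbeddedChain P Z S) {a : ℕ → ℝ}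
    (hasum : Summable a) (ha0 : ∀ k, 0 ≤ a k)
    (ha : ∀ g : Space d → ℝ, Measurable g → (∀ x, |g x| ≤ 1) →
      ∀ k, ∫ x, |∫ y, g y ∂(X.postJump ^ k) x - ∫ y, g y ∂π| ∂π ≤ a k)
    (htv : Summable fun n => tvNorm (P.map (Z n)) π) :
    ∃ K : ℝ, 0 ≤ K ∧ ∀ F : ℕ → Space d × ℝ → ℝ, (∀ i, Measurable (F i)) →
      ∀ n : ℕ, (∀ i < n, ∀ p, |F i p| ≤ 1) →
      Var[fun ω => ∑ i ∈ Finset.range n, F i (Z i ω, S (i + 1) ω); P] ≤ K * n := by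
  have htv' := (summable_nat_add_iff 1).2 htv
  have htv0 : ∀ n, 0 ≤ tvNorm (P.map (Z (n + 1))) π := fun n => tvNorm_nonneg _ _
  have hT0 : 0 ≤ ∑' n, tvNorm (P.map (Z (n + 1))) π := tsum_nonneg htv0
  have hA0 : 0 ≤ ∑' n, a n := tsum_nonneg ha0
  -- Increment when one summand is added: its variance is at most `1`, and twice the sum of its
  -- covariances with the earlier ones gives the factor `2 * 2`.
  refine ⟨1 + 4 * (∑' n, a n + 2 * ∑' n, tvNorm (P.map (Z (n + 1))) π), by positivity,
    fun F hF n => ?_⟩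
  have hYm : ∀ i, Measurable fun ω => F i (Z i ω, S (i + 1) ω) := fun i =>
    (hF i).comp ((h.measurable_Z i).prodMk (h.measurable_S i))
  induction n with
  | zero =>
    intro _
    have h0 : Var[fun _ : Ω => (0 : ℝ); P] = 0 := variance_zero P
    simp [h0]
  | succ n ih =>
    intro hF1
    have hL : ∀ i ∈ Finset.range (n + 1), MemLp (fun ω => F i (Z i ω, S (i + 1) ω)) 2 P :=
      fun i hi => MemLp.of_bound (hYm i).aestronglyMeasurable 1
        (Eventually.of_forall fun _ => hF1 i (Finset.mem_range.1 hi) _)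
    have hLn := hL n (Finset.self_mem_range_succ n)
    have hL' : ∀ i ∈ Finset.range n, MemLp (fun ω => F i (Z i ω, S (i + 1) ω)) 2 P :=
      fun i hi => hL i (Finset.mem_range.2 (Nat.lt_succ_of_lt (Finset.mem_range.1 hi)))
    have hLs : MemLp (fun ω => ∑ i ∈ Finset.range n, F i (Z i ω, S (i + 1) ω)) 2 P :=
      memLp_finsetSum _ hL'
    simp only [Finset.sum_range_succ]
    rw [variance_fun_add hLs hLn, covariance_fun_sum_left' hL' hLn]
    have hvar : Var[fun ω => F n (Z n ω, S (n + 1) ω); P] ≤ 1 := by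
      refine (variance_le_expectation_sq (hYm n).aestronglyMeasurable).trans ?_
      refine (le_abs_self _).trans (MarkovChain.abs_integral_le_of_abs_le fun ω => ?_)
      simp only [Pi.pow_apply, abs_pow]
      exact pow_le_one₀ (abs_nonneg _) (hF1 n n.lt_succ_self _)
    have hcov : ∑ i ∈ Finset.range n, cov[fun ω => F i (Z i ω, S (i + 1) ω),
        fun ω => F n (Z n ω, S (n + 1) ω); P] ≤
        2 * (∑' n, a n + 2 * ∑' n, tvNorm (P.map (Z (n + 1))) π) := by
      have hterm : ∀ i ∈ Finset.range n, cov[fun ω => F i (Z i ω, S (i + 1) ω),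
          fun ω => F n (Z n ω, S (n + 1) ω); P] ≤
          2 * (a (n - 1 - i) + 2 * tvNorm (P.map (Z (i + 1))) π) := by
        intro i hi
        have hin := Finset.mem_range.1 hi
        -- The lag `n - 1 - i` is chosen so that `i + 1 + (n - 1 - i) = n`.
        have := h.abs_covariance_le ha (hF i) (hF1 i (by omega)) (hF n) (hF1 n (by omega)) i
          (n - 1 - i)
        have e : i + 1 + (n - 1 - i) = n := by omega
        simp only [e] at this
        exact (le_abs_self _).trans this
      refine (Finset.sum_le_sum hterm).trans ?_
      rw [← Finset.mul_sum, Finset.sum_add_distrib, ← Finset.mul_sum, Finset.sum_range_reflect]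
      gcongr
      · exact hasum.sum_le_tsum _ fun k _ => ha0 k
      · exact htv'.sum_le_tsum _ fun k _ => htv0 k
    have := ih fun i hi => hF1 i (by omega)
    push_cast
    linarith

end PDMP

namespace PDMP

variable {d : ℕ} {X : PDMP d} {Ω : Type*} [MeasurableSpace Ω] {P : Measure Ω}
  [IsProbabilityMeasure P] {Z : ℕ → Ω → Space d} {S : ℕ → Ω → ℝ}

/-- For a geometrically ergodic embedded chain, the variance of an average of `n` functions
bounded by `B` is of order `B ^ 2 / n`. -/
theorem IsEmbeddedChain.exists_variance_average_le (h : X.IsEmbeddedChain P Z S)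
    {π : Measure (Space d)} [IsProbabilityMeasure π] (hE : π X.E = 1) {b : ℝ} (hb : 1 < b)
    (hgeom : ∀ x ∈ X.E,
      (fun n : ℕ => tvNorm ((X.postJump ^ n) x) π) =O[atTop] fun n : ℕ => (b ^ n)⁻¹)
    (hgeomZ : (fun n : ℕ => tvNorm (P.map (Z n)) π) =O[atTop] fun n : ℕ => (b ^ n)⁻¹) :
    ∃ K : ℝ, 0 ≤ K ∧ ∀ F : ℕ → Space d × ℝ → ℝ, (∀ i, Measurable (F i)) →
      ∀ n : ℕ, 1 ≤ n → ∀ B : ℝ, 0 < B → (∀ i < n, ∀ p, |F i p| ≤ B) →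
      MemLp (fun ω => (1 / (n : ℝ)) * ∑ i ∈ Finset.range n, F i (Z i ω, S (i + 1) ω)) 2 P ∧
      Var[fun ω => (1 / (n : ℝ)) * ∑ i ∈ Finset.range n, F i (Z i ω, S (i + 1) ω); P] ≤
        K * (B ^ 2 / n) := by
  have hb0 : 0 < b := one_pos.trans hb
  have hr1 : b⁻¹ < 1 := inv_lt_one_of_one_lt₀ hb
  have hae : ∀ᵐ x ∂π, x ∈ X.E :=
    (prob_compl_eq_zero_iff X.isOpen_E.measurableSet).2 hE
  have hgeom' : ∀ᵐ x ∂π,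
      (fun n : ℕ => tvNorm ((X.postJump ^ n) x) π) =O[atTop] fun n : ℕ => (b ^ n)⁻¹ := by
    filter_upwards [hae] with x hx using hgeom x hx
  obtain ⟨x₀, hx₀⟩ : X.E.Nonempty := by
    by_contra hne
    rw [not_nonempty_iff_eq_empty] at hne
    simp [hne] at hE
  have hinv : Kernel.Invariant X.postJump π := MarkovChain.invariant_of_isBigO hb (hgeom x₀ hx₀)
  obtain ⟨A, N, hA, hpos, hN, herg⟩ := MarkovChain.exists_ergodicOn hb hgeom'
  obtain ⟨a, hasum, ha0, ha⟩ := herg.exists_summable_rate hinv hA hpos hN (by positivity) hr1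
  have htv : Summable fun n => tvNorm (P.map (Z n)) π := by
    refine summable_of_isBigO_nat ?_ hgeomZ
    simpa only [inv_pow] using summable_geometric_of_lt_one (by positivity) hr1
  obtain ⟨K, hK, hvar⟩ := h.exists_variance_sum_le hasum ha0 ha htv
  refine ⟨K, hK, fun F hF n hn B hB hFB => ⟨?_, ?_⟩⟩
  · have hL : ∀ i ∈ Finset.range n, MemLp (fun ω => F i (Z i ω, S (i + 1) ω)) 2 P :=
      fun i hi => MemLp.of_bound ((hF i).comp
        ((h.measurable_Z i).prodMk (h.measurable_S i))).aestronglyMeasurable B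
        (Eventually.of_forall fun _ => hFB i (Finset.mem_range.1 hi) _)
    have hsum : MemLp (fun ω => ∑ i ∈ Finset.range n, F i (Z i ω, S (i + 1) ω)) 2 P :=
      memLp_finsetSum _ hL
    exact hsum.const_mul _
  · have hn0 : (0 : ℝ) < n := by exact_mod_cast hn
    -- Rescaling by `B` reduces to functions bounded by `1`. Only the indices below `n` are
    -- constrained, so `B` may grow with `n`.
    have hscale : (fun ω => (1 / (n : ℝ)) * ∑ i ∈ Finset.range n, F i (Z i ω, S (i + 1) ω)) =
        fun ω => (B / n) * ∑ i ∈ Finset.range n, (fun p => B⁻¹ * F i p) (Z i ω, S (i + 1) ω) := by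
      funext ω
      rw [← Finset.mul_sum]
      field_simp
    rw [hscale, variance_const_mul]
    have := hvar (fun i p => B⁻¹ * F i p) (fun i => (hF i).const_mul _) n fun i hi p => by
      rw [abs_mul, abs_of_pos (inv_pos.2 hB), inv_mul_le_iff₀ hB, mul_one]
      exact hFB i hi p
    calc _ ≤ (B / n) ^ 2 * (K * n) := mul_le_mul_of_nonneg_left this (by positivity)
      _ = K * (B ^ 2 / n) := by field_simp

end PDMP

/-! ### Bandwidth bounds and the estimators -/

theorem bandwidth_pos {v α : ℝ} (hv : 0 < v) (i : ℕ) : 0 < bandwidth v α i := by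
  unfold bandwidth
  positivity

/-- The inverse bandwidths increase with the index, so over `i < n` they are controlled by the value
with `i + 1 = n`. The exponents in the variance rates originate here. -/
theorem inv_bandwidth_pow_le {v α : ℝ} (hv : 0 < v) (hα : 0 < α) (m : ℕ) {i n : ℕ} (hi : i < n) :
    (bandwidth v α i ^ m)⁻¹ ≤ (v ^ m)⁻¹ * (n : ℝ) ^ (α * m) := by
  have h0 : (0 : ℝ) < (i : ℝ) + 1 := by positivity
  have h1 : (bandwidth v α i ^ m)⁻¹ = (v ^ m)⁻¹ * ((i : ℝ) + 1) ^ (α * m) := by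
    rw [bandwidth, mul_pow, mul_inv, Real.rpow_neg h0.le, inv_pow, inv_inv,
      ← Real.rpow_mul_natCast h0.le]
  rw [h1]
  have h2 : (i : ℝ) + 1 ≤ n := by exact_mod_cast hi
  gcongr

theorem IsSmoothingKernel.exists_pos_bound {V : Type*} [NormedAddCommGroup V] [MeasureSpace V]
    {K : V → ℝ} {δ : ℝ} (hK : IsSmoothingKernel K δ) : ∃ c > 0, ∀ u, |K u| ≤ c := by
  obtain ⟨c, hc⟩ := hK.bounded
  refine ⟨max c 1, by positivity, fun u => ?_⟩
  rw [abs_of_nonneg (hK.nonneg u)]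
  exact (hc u).trans (le_max_left _ _)

theorem proposition1 {d : ℕ} (X : PDMP d)
    {Ω : Type*} [MeasurableSpace Ω] (P : Measure Ω) [IsProbabilityMeasure P]
    (Z : ℕ → Ω → Space d) (S : ℕ → Ω → ℝ) (hZS : X.IsEmbeddedChain P Z S)
    (νinf : Measure (Space d)) [IsProbabilityMeasure νinf] (hνinf : νinf X.E = 1)
    (b : ℝ) (hb : 1 < b)
    (hgeom : ∀ x ∈ X.E,
      (fun n : ℕ => tvNorm ((X.postJump ^ n) x) νinf) =O[atTop] fun n : ℕ => (b ^ n)⁻¹)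
    (hgeomZ : (fun n : ℕ => tvNorm (P.map (Z n)) νinf) =O[atTop] fun n : ℕ => (b ^ n)⁻¹)
    (δ : ℝ) (hδ : 0 < δ)
    (Kd : Space d → ℝ) (hKd : IsSmoothingKernel Kd δ) (hKdLip : ∃ L : ℝ≥0, LipschitzWith L Kd)
    (K1 : ℝ → ℝ) (hK1 : IsSmoothingKernel K1 δ)
    (α β v₀ w₀ : ℝ) (hα : 0 < α) (hβ : 0 < β) (hv₀ : 0 < v₀) (hw₀ : 0 < w₀)
    (hαβ : 2 * (α * d + β) < 1)
    (D : Set (Space d × ℝ)) (hD : D ∈ X.rectangles) :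
    ∃ M : ℝ, ∀ n : ℕ, 1 ≤ n → ∀ x t, (x, t) ∈ D →
      MemLp (estF Kd K1 v₀ w₀ α β Z S n x t) 2 P ∧
      MemLp (estG Kd v₀ α Z S n x t) 2 P ∧
      MemLp (estNu Kd v₀ α Z n x) 2 P ∧
      variance (estF Kd K1 v₀ w₀ α β Z S n x t) P ≤ M * (n : ℝ) ^ (2 * (α * d + β) - 1) ∧
      variance (estG Kd v₀ α Z S n x t) P + variance (estNu Kd v₀ α Z n x) P
        ≤ M * (n : ℝ) ^ (2 * (α * d) - 1) := by
  -- `K` is fixed before the point `(x, t)`, and the sup bounds `BF` and `BG` do not involve that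
  -- point either; this makes the variance bounds uniform.
  obtain ⟨K, hK0, hK⟩ := hZS.exists_variance_average_le hνinf hb hgeom hgeomZ
  obtain ⟨cd, hcd, hKdb⟩ := hKd.exists_pos_bound
  obtain ⟨c1, hc1, hK1b⟩ := hK1.exists_pos_bound
  set BF : ℝ := (v₀ ^ d)⁻¹ * w₀⁻¹ * cd * c1 with hBF
  set BG : ℝ := (v₀ ^ d)⁻¹ * cd with hBG
  have hBF0 : 0 < BF := by positivity
  have hBG0 : 0 < BG := by positivity
  -- A single constant serves both rates: the first summand is for `estF`, the second for `estG` and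
  -- `estNu`, which share the bound `BG`.
  refine ⟨K * BF ^ 2 + 2 * (K * BG ^ 2), fun n hn x t _ => ?_⟩
  have hn0 : (0 : ℝ) < n := by exact_mod_cast hn
  have hmKd : ∀ i, Measurable fun p : Space d × ℝ => Kd ((bandwidth v₀ α i)⁻¹ • (p.1 - x)) :=
    fun i => hKd.continuous.measurable.comp (by fun_prop)
  have hpow : ∀ B γ : ℝ, K * ((B * (n : ℝ) ^ γ) ^ 2 / n) = K * B ^ 2 * (n : ℝ) ^ (2 * γ - 1) := by
    intro B γ
    rw [Real.rpow_sub_one hn0.ne', mul_comm 2 γ, Real.rpow_mul hn0.le, Real.rpow_two]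
    ring
  have hinvd : ∀ i < n, 1 / bandwidth v₀ α i ^ d ≤ (v₀ ^ d)⁻¹ * (n : ℝ) ^ (α * d) := by
    intro i hi
    rw [one_div]
    exact inv_bandwidth_pow_le hv₀ hα d hi
  have hinvw : ∀ i < n, (bandwidth w₀ β i)⁻¹ ≤ w₀⁻¹ * (n : ℝ) ^ β := by
    intro i hi
    simpa using inv_bandwidth_pow_le hw₀ hβ 1 hi
  have hinvd0 : ∀ i, 0 < 1 / bandwidth v₀ α i ^ d := fun i =>
    one_div_pos.2 (pow_pos (bandwidth_pos hv₀ i) d)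
  obtain ⟨hF2, hFv⟩ := hK (fun i p => (1 / (bandwidth v₀ α i ^ d * bandwidth w₀ β i)) *
      Kd ((bandwidth v₀ α i)⁻¹ • (p.1 - x)) * K1 ((p.2 - t) / bandwidth w₀ β i))
    (fun i => ((hmKd i).const_mul _).mul (hK1.continuous.measurable.comp (by fun_prop)))
    n hn (BF * (n : ℝ) ^ (α * d + β)) (by positivity) (fun i hi p => by
      have h1 : 1 / (bandwidth v₀ α i ^ d * bandwidth w₀ β i) =
          1 / bandwidth v₀ α i ^ d * (bandwidth w₀ β i)⁻¹ := by
        rw [one_div, mul_inv, one_div]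
      have h2 := (inv_pos.2 (bandwidth_pos (α := β) hw₀ i)).le
      rw [abs_mul, abs_mul, h1, abs_of_nonneg (mul_nonneg (hinvd0 i).le h2), Real.rpow_add hn0]
      calc 1 / bandwidth v₀ α i ^ d * (bandwidth w₀ β i)⁻¹ *
            |Kd ((bandwidth v₀ α i)⁻¹ • (p.1 - x))| * |K1 ((p.2 - t) / bandwidth w₀ β i)|
          ≤ ((v₀ ^ d)⁻¹ * (n : ℝ) ^ (α * d)) * (w₀⁻¹ * (n : ℝ) ^ β) * cd * c1 := by
            gcongr
            · exact hinvd i hi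
            · exact hinvw i hi
            · exact hKdb _
            · exact hK1b _
        _ = _ := by
            rw [hBF]
            ring)
  obtain ⟨hG2, hGv⟩ := hK (fun i p => (1 / bandwidth v₀ α i ^ d) *
      Kd ((bandwidth v₀ α i)⁻¹ • (p.1 - x)) * (Ioi t).indicator 1 p.2)
    (fun i => ((hmKd i).const_mul _).mul
      ((measurable_one.indicator measurableSet_Ioi).comp measurable_snd))
    n hn (BG * (n : ℝ) ^ (α * d)) (by positivity) (fun i hi p => by
      have h1 : |(Ioi t).indicator (1 : ℝ → ℝ) p.2| ≤ 1 := by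
        simp only [indicator]
        split_ifs <;> simp
      rw [abs_mul, abs_mul, abs_of_pos (hinvd0 i)]
      calc 1 / bandwidth v₀ α i ^ d * |Kd ((bandwidth v₀ α i)⁻¹ • (p.1 - x))| *
            |(Ioi t).indicator (1 : ℝ → ℝ) p.2|
          ≤ ((v₀ ^ d)⁻¹ * (n : ℝ) ^ (α * d)) * cd * 1 := by
            gcongr
            · exact hinvd i hi
            · exact hKdb _
        _ = _ := by
            rw [hBG]
            ring)
  obtain ⟨hN2, hNv⟩ := hK (fun i p => (1 / bandwidth v₀ α i ^ d) *
      Kd ((bandwidth v₀ α i)⁻¹ • (p.1 - x)))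
    (fun i => (hmKd i).const_mul _)
    n hn (BG * (n : ℝ) ^ (α * d)) (by positivity) (fun i hi p => by
      rw [abs_mul, abs_of_pos (hinvd0 i)]
      calc 1 / bandwidth v₀ α i ^ d * |Kd ((bandwidth v₀ α i)⁻¹ • (p.1 - x))|
          ≤ ((v₀ ^ d)⁻¹ * (n : ℝ) ^ (α * d)) * cd := by
            gcongr
            · exact hinvd i hi
            · exact hKdb _
        _ = _ := by
            rw [hBG]
            ring)
  rw [hpow] at hFv hGv hNv
  refine ⟨hF2, hG2, hN2, hFv.trans ?_, (add_le_add hGv hNv).trans ?_⟩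
  · gcongr
    exact le_add_of_nonneg_right (by positivity)
  · rw [← add_mul, ← two_mul]
    gcongr
    exact le_add_of_nonneg_left (by positivity)
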